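/- Let $n\ge 3$, $\rho>0$, and let $\phi=\phi(r,s)$ be a positive $C^\infty$ function on $[0,\rho)\times(-\rho,\rho)$ such that $$F(x,y)=|y|\,\phi(r,s),\qquad r=|x|,\quad s=\frac{\langle x,y\rangle}{|y|},$$ is a Finsler metric on the open ball $B^n(\rho)\subset\mathbb R^n$ (that is, $F$ is $C^\infty$ and positive for $y\neq0$, positively homogeneous of degree one in $y$, and $g_{ij}=\frac12\,\partial^2(F^2)/\partial y^i\partial y^j$ is positive definite for $y\ne 0$). Put $$Q=\frac1{2r}\,\frac{s\phi_{rs}+r\phi_{ss}-\phi_r}{\phi-s\phi_s+(r^2-s^2)\phi_{ss}},\qquad P=\frac{1}{2r\phi}(s\phi_r+r\phi_s)-\frac{Q}{\phi}\{s\phi+(r^2-s^2)\phi_s\},$$ $$R_1=P^2-\frac1r(sP_r+rP_s)+2Q\,[1+sP+(r^2-s^2)P_s],$$ $$R_2=\frac1r(2Q_r-sQ_{rs}-rQ_{ss})+2Q(2Q-sQ_s)+(r^2-s^2)\big(2QQ_{ss}-[Q_s]^2\big).$$ Let $R_j{}^i{}_{kl}$ be the Riemann curvature tensor of the Berwald connection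 of $F$ and $R^i{}_k=R_j{}^i{}_{kl}y^jy^l$. Then, for every real constant $K$, $F$ is of constant flag curvature $K$, i.e. $$R^i{}_k=K\{F^2\delta^i_k-g_{kl}y^ly^i\}\quad\text{for all }x\in B^n(\rho),\ y\neq0,$$ if and only if $$R_1=K\phi^2\quad\text{and}\quad R_2=0\qquad\text{for all }0<r<\rho,\ |s|\le r.$$ -/

import Mathlib

open scoped ContDiff

noncomputable section

namespace Finsler

section FinslerGeometry

/-! Finsler geometry of a function `F x y` on an open set of `ℝⁿ`, in the standard coordinates
`x^i` and the induced coordinates `y^i` on the tangent spaces. -/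

variable {n : ℕ}

/-- The partial derivative `∂f/∂x^k` of a function `f x y` of a point and a tangent vector. -/
def pdx (k : Fin n) (f : EuclideanSpace ℝ (Fin n) → EuclideanSpace ℝ (Fin n) → ℝ) :
    EuclideanSpace ℝ (Fin n) → EuclideanSpace ℝ (Fin n) → ℝ :=
  fun x y => fderiv ℝ (fun u => f u y) x (EuclideanSpace.single k 1)

/-- The partial derivative `∂f/∂y^k` of a function `f x y` of a point and a tangent vector. -/
def pdy (k : Fin n) (f : EuclideanSpace ℝ (Fin n) → EuclideanSpace ℝ (Fin n) → ℝ) :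
    EuclideanSpace ℝ (Fin n) → EuclideanSpace ℝ (Fin n) → ℝ :=
  fun x y => fderiv ℝ (fun v => f x v) y (EuclideanSpace.single k 1)

/-- The fundamental tensor `g_{ij} = (1/2) ∂²(F²)/∂y^i∂y^j`. -/
def fundamentalTensor (F : EuclideanSpace ℝ (Fin n) → EuclideanSpace ℝ (Fin n) → ℝ)
    (x y : EuclideanSpace ℝ (Fin n)) : Matrix (Fin n) (Fin n) ℝ :=
  Matrix.of fun i j => (1 / 2) * pdy i (pdy j (fun u v => F u v ^ 2)) x y

/-- `F` is a Finsler metric on the set `U`: smooth off the zero section, positive,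
positively homogeneous of degree one, and strongly convex. -/
structure IsFinslerMetricOn (U : Set (EuclideanSpace ℝ (Fin n)))
    (F : EuclideanSpace ℝ (Fin n) → EuclideanSpace ℝ (Fin n) → ℝ) : Prop where
  smooth : ContDiffOn ℝ ∞
    (fun p : EuclideanSpace ℝ (Fin n) × EuclideanSpace ℝ (Fin n) => F p.1 p.2) (U ×ˢ {0}ᶜ)
  pos : ∀ x ∈ U, ∀ y, y ≠ 0 → 0 < F x y
  homogeneous : ∀ x ∈ U, ∀ y, ∀ c : ℝ, 0 < c → F x (c • y) = c * F x y
  posDef : ∀ x ∈ U, ∀ y, y ≠ 0 → (fundamentalTensor F x y).PosDef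

/-- The spray coefficients
`G^i = (1/4) g^{il} ( (∂²(F²)/∂x^k∂y^l) y^k - ∂(F²)/∂x^l )`. -/
def sprayCoeff (F : EuclideanSpace ℝ (Fin n) → EuclideanSpace ℝ (Fin n) → ℝ) (i : Fin n)
    (x y : EuclideanSpace ℝ (Fin n)) : ℝ :=
  (1 / 4) * ∑ l, (fundamentalTensor F x y)⁻¹ i l *
    (∑ k, pdx k (pdy l (fun u v => F u v ^ 2)) x y * y k - pdx l (fun u v => F u v ^ 2) x y)

/-- The nonlinear connection coefficients `N^i_j = ∂G^i/∂y^j`. -/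
def nonlinearConnection (F : EuclideanSpace ℝ (Fin n) → EuclideanSpace ℝ (Fin n) → ℝ)
    (i j : Fin n) : EuclideanSpace ℝ (Fin n) → EuclideanSpace ℝ (Fin n) → ℝ :=
  pdy j (sprayCoeff F i)

/-- The Berwald connection coefficients `Γ^i_{jk} = ∂²G^i/∂y^j∂y^k`. -/
def berwaldConnection (F : EuclideanSpace ℝ (Fin n) → EuclideanSpace ℝ (Fin n) → ℝ)
    (i j k : Fin n) : EuclideanSpace ℝ (Fin n) → EuclideanSpace ℝ (Fin n) → ℝ :=
  pdy j (pdy k (sprayCoeff F i))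

/-- The horizontal derivative `δf/δx^k = ∂f/∂x^k - N^m_k ∂f/∂y^m`. -/
def horizontalDeriv (F : EuclideanSpace ℝ (Fin n) → EuclideanSpace ℝ (Fin n) → ℝ) (k : Fin n)
    (f : EuclideanSpace ℝ (Fin n) → EuclideanSpace ℝ (Fin n) → ℝ)
    (x y : EuclideanSpace ℝ (Fin n)) : ℝ :=
  pdx k f x y - ∑ m, nonlinearConnection F m k x y * pdy m f x y

/-- The Riemann curvature tensor of the Berwald connection,
`R_j{}^i{}_{kl} = δΓ^i_{jl}/δx^k - δΓ^i_{jk}/δx^l + Γ^i_{km} Γ^m_{jl} - Γ^i_{lm} Γ^m_{jk}`. -/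
def berwaldCurvature (F : EuclideanSpace ℝ (Fin n) → EuclideanSpace ℝ (Fin n) → ℝ)
    (j i k l : Fin n) (x y : EuclideanSpace ℝ (Fin n)) : ℝ :=
  horizontalDeriv F k (berwaldConnection F i j l) x y
    - horizontalDeriv F l (berwaldConnection F i j k) x y
    + ∑ m, (berwaldConnection F i k m x y * berwaldConnection F m j l x y
        - berwaldConnection F i l m x y * berwaldConnection F m j k x y)

/-- The Riemann curvature `R^i_k = R_j{}^i{}_{kl} y^j y^l`. -/
def riemannCurvature (F : EuclideanSpace ℝ (Fin n) → EuclideanSpace ℝ (Fin n) → ℝ)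
    (i k : Fin n) (x y : EuclideanSpace ℝ (Fin n)) : ℝ :=
  ∑ j, ∑ l, berwaldCurvature F j i k l x y * y j * y l

/-- `F` is of constant flag curvature `K` on `U`:
`R^i_k = K (F² δ^i_k - g_{kl} y^l y^i)` for all `x ∈ U` and `y ≠ 0`. -/
def HasConstantFlagCurvatureOn (U : Set (EuclideanSpace ℝ (Fin n)))
    (F : EuclideanSpace ℝ (Fin n) → EuclideanSpace ℝ (Fin n) → ℝ) (K : ℝ) : Prop :=
  ∀ x ∈ U, ∀ y, y ≠ 0 → ∀ i k : Fin n,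
    riemannCurvature F i k x y =
      K * (F x y ^ 2 * (if i = k then 1 else 0)
        - (∑ l, fundamentalTensor F x y k l * y l) * y i)

/-- The function `F = |y| φ(r, s)` with `r = |x|` and `s = ⟨x, y⟩ / |y|`. -/
def sphericallySymmetric (n : ℕ) (φ : ℝ → ℝ → ℝ) (x y : EuclideanSpace ℝ (Fin n)) : ℝ :=
  ‖y‖ * φ ‖x‖ (inner ℝ x y / ‖y‖)

end FinslerGeometry

section Scalars

/-! The scalar functions of `r` and `s` attached to `φ`. -/

/-- The partial derivative `f_r` of a function `f(r, s)`. -/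
def pdr (f : ℝ → ℝ → ℝ) : ℝ → ℝ → ℝ := fun r s => deriv (fun t => f t s) r

/-- The partial derivative `f_s` of a function `f(r, s)`. -/
def pds (f : ℝ → ℝ → ℝ) : ℝ → ℝ → ℝ := fun r s => deriv (fun t => f r t) s

/-- `Q = (1/2r) (s φ_{rs} + r φ_{ss} - φ_r) / (φ - s φ_s + (r² - s²) φ_{ss})`. -/
def scalarQ (φ : ℝ → ℝ → ℝ) (r s : ℝ) : ℝ :=
  1 / (2 * r) * ((s * pds (pdr φ) r s + r * pds (pds φ) r s - pdr φ r s) /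
    (φ r s - s * pds φ r s + (r ^ 2 - s ^ 2) * pds (pds φ) r s))

/-- `P = (s φ_r + r φ_s) / (2rφ) - (Q/φ) (s φ + (r² - s²) φ_s)`. -/
def scalarP (φ : ℝ → ℝ → ℝ) (r s : ℝ) : ℝ :=
  1 / (2 * r * φ r s) * (s * pdr φ r s + r * pds φ r s)
    - scalarQ φ r s / φ r s * (s * φ r s + (r ^ 2 - s ^ 2) * pds φ r s)

/-- `R₁ = P² - (1/r)(s P_r + r P_s) + 2Q (1 + s P + (r² - s²) P_s)`. -/
def scalarR1 (φ : ℝ → ℝ → ℝ) (r s : ℝ) : ℝ :=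
  scalarP φ r s ^ 2 - 1 / r * (s * pdr (scalarP φ) r s + r * pds (scalarP φ) r s)
    + 2 * scalarQ φ r s * (1 + s * scalarP φ r s + (r ^ 2 - s ^ 2) * pds (scalarP φ) r s)

/-- `R₂ = (1/r)(2Q_r - s Q_{rs} - r Q_{ss}) + 2Q(2Q - s Q_s)
      + (r² - s²)(2Q Q_{ss} - (Q_s)²)`. -/
def scalarR2 (φ : ℝ → ℝ → ℝ) (r s : ℝ) : ℝ :=
  1 / r * (2 * pdr (scalarQ φ) r s - s * pds (pdr (scalarQ φ)) r s
      - r * pds (pds (scalarQ φ)) r s)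
    + 2 * scalarQ φ r s * (2 * scalarQ φ r s - s * pds (scalarQ φ) r s)
    + (r ^ 2 - s ^ 2) *
      (2 * scalarQ φ r s * pds (pds (scalarQ φ)) r s - pds (scalarQ φ) r s ^ 2)

end Scalars

end Finsler

end

/-!
The metric is invariant under rotations, so its spray lies in the plane of `x` and `y`, and it is
`G = |y| P y + |y|² Q x` (`sprayCoeff_sphericallySymmetric`). Indeed, the definitions of `P` and `Q`
are equivalent to two transport equations for `φ` and `φ_s` along the spray (`transport_phi`,
`transport_phi_s`), and these are the Euler-Lagrange equations of `F²`, which determine `G` since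
`g` is nondegenerate.

By Euler's relation, `R^i_k = 2 ∂G^i/∂x^k - S(N^i_k) - N^i_m N^m_k` for the spray
`S = y^l ∂/∂x^l - 2 G^l ∂/∂y^l` (`riemannCurvature_eq_spray`). Inserting `G` gives, with `u = |y|`,
`R^i_k = u² R₁ δ^i_k + y^i (u R₃ x_k - (R₁ + s R₃) y_k) + x^i R₂ (u² x_k - u s y_k)`
(`riemannCurvature_sphericallySymmetric`) for a third scalar `R₃`. This scalar is not independent:
the transport equations form an overdetermined first order system for `φ`, whose integrability
condition is `φ R₃ + φ_s R₁ + (s φ + (r² - s²) φ_s) R₂ = 0` (`scalarR3_eq`); it says that `R^i_k` is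
annihilated by `∂F/∂y^i`.

If `R₁ = K φ²` and `R₂ = 0`, this identity yields `R₃ = -K φ φ_s`, and the curvature formula becomes
that of constant flag curvature. Conversely, as `n ≥ 3` there is a vector orthogonal to `x` and `y`,
and testing the curvature equation on it gives `R₁ = K φ²`; testing it on the part of `x` orthogonal
to `y` gives `R₂ = 0` for `|s| < r`, and `|s| = r` follows by continuity.

The formulas hold where `x ≠ 0`, since `|x|` is not smooth at the origin; the curvature is
continuous there (`riemannCurvature_smooth`), which settles the origin. Positivity of the
denominator of `Q` is a consequence of strong convexity (`mem_regularSet`).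
-/

noncomputable section

namespace Finsler

/-! ### Calculus of functions of two variables -/

section Calculus

variable {E F : Type*} [NormedAddCommGroup E] [NormedSpace ℝ E]
  [NormedAddCommGroup F] [NormedSpace ℝ F]

/-- A curried function of two variables is smooth on `O` as a function of the pair. -/
def JointlySmoothOn (f : E → F → ℝ) (O : Set (E × F)) : Prop :=
  ContDiffOn ℝ ∞ (fun p : E × F => f p.1 p.2) O

/-- The derivative of `f` in a direction `v` of the product space, as a curried function. -/
def dirDeriv (v : E × F) (f : E → F → ℝ) (x : E) (y : F) : ℝ :=
  fderiv ℝ (fun p : E × F => f p.1 p.2) (x, y) v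

variable {f g : E → F → ℝ} {O : Set (E × F)} {x : E} {y : F}

theorem JointlySmoothOn.differentiableAt (hf : JointlySmoothOn f O) (hO : IsOpen O)
    (h : (x, y) ∈ O) : DifferentiableAt ℝ (fun p : E × F => f p.1 p.2) (x, y) :=
  ((hf.contDiffAt (hO.mem_nhds h)).differentiableAt (by simp))

theorem JointlySmoothOn.hasFDerivAt (hf : JointlySmoothOn f O) (hO : IsOpen O)
    (h : (x, y) ∈ O) :
    HasFDerivAt (fun p : E × F => f p.1 p.2) (fderiv ℝ (fun p : E × F => f p.1 p.2) (x, y))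
      (x, y) :=
  (hf.differentiableAt hO h).hasFDerivAt

theorem JointlySmoothOn.mono (hf : JointlySmoothOn f O) {O' : Set (E × F)} (h : O' ⊆ O) :
    JointlySmoothOn f O' :=
  ContDiffOn.mono hf h

theorem JointlySmoothOn.continuousOn (hf : JointlySmoothOn f O) :
    ContinuousOn (fun p : E × F => f p.1 p.2) O :=
  ContDiffOn.continuousOn hf

theorem JointlySmoothOn.congr (hf : JointlySmoothOn f O)
    (h : ∀ x y, (x, y) ∈ O → g x y = f x y) : JointlySmoothOn g O :=
  ContDiffOn.congr hf fun p hp => h p.1 p.2 hp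

theorem JointlySmoothOn.dirDeriv (hf : JointlySmoothOn f O) (hO : IsOpen O) (v : E × F) :
    JointlySmoothOn (dirDeriv v f) O :=
  (ContDiffOn.fderiv_of_isOpen hf hO (m := ∞) (by simp)).clm_apply contDiffOn_const

/-- Chain rule along a pair of curves. -/
theorem JointlySmoothOn.hasDerivAt_comp (hf : JointlySmoothOn f O) (hO : IsOpen O)
    {c : ℝ → E} {d : ℝ → F} {a : E} {b : F} {t : ℝ} (hc : HasDerivAt c a t)
    (hd : HasDerivAt d b t) (h : (c t, d t) ∈ O) :
    HasDerivAt (fun τ => f (c τ) (d τ)) (Finsler.dirDeriv (a, b) f (c t) (d t)) t :=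
  HasFDerivAt.comp_hasDerivAt (f := fun τ => (c τ, d τ)) t (hf.hasFDerivAt hO h) (hc.prodMk hd)

theorem fderiv_fst_eq_dirDeriv (hf : JointlySmoothOn f O) (hO : IsOpen O) (h : (x, y) ∈ O)
    (v : E) : fderiv ℝ (fun u => f u y) x v = dirDeriv (v, 0) f x y := by
  have := HasFDerivAt.comp (f := fun u : E => (u, y)) x (hf.hasFDerivAt hO h)
    ((hasFDerivAt_id x).prodMk (hasFDerivAt_const y x))
  have h2 : fderiv ℝ (fun u => f u y) x = _ := this.fderiv
  rw [h2]; rfl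

theorem fderiv_snd_eq_dirDeriv (hf : JointlySmoothOn f O) (hO : IsOpen O) (h : (x, y) ∈ O)
    (w : F) : fderiv ℝ (fun z => f x z) y w = dirDeriv (0, w) f x y := by
  have := HasFDerivAt.comp (f := fun z : F => (x, z)) y (hf.hasFDerivAt hO h)
    ((hasFDerivAt_const x y).prodMk (hasFDerivAt_id y))
  have h2 : fderiv ℝ (fun z => f x z) y = _ := this.fderiv
  rw [h2]; rfl

theorem dirDeriv_congr (hO : IsOpen O) (h : ∀ x y, (x, y) ∈ O → f x y = g x y)
    (hxy : (x, y) ∈ O) (v : E × F) : dirDeriv v f x y = dirDeriv v g x y := by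
  have : (fun p : E × F => f p.1 p.2) =ᶠ[nhds (x, y)] fun p => g p.1 p.2 := by
    filter_upwards [hO.mem_nhds hxy] with p hp using h p.1 p.2 hp
  unfold dirDeriv
  rw [this.fderiv_eq]

theorem dirDeriv_comm (hf : JointlySmoothOn f O) (hO : IsOpen O) (h : (x, y) ∈ O)
    (v w : E × F) : dirDeriv v (dirDeriv w f) x y = dirDeriv w (dirDeriv v f) x y := by
  have hs : IsSymmSndFDerivAt ℝ (fun p : E × F => f p.1 p.2) (x, y) :=
    (hf.contDiffAt (hO.mem_nhds h)).isSymmSndFDerivAt (by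
      rw [minSmoothness_of_isRCLikeNormedField]; exact ENat.LEInfty.out)
  have hd : DifferentiableAt ℝ (fderiv ℝ (fun p : E × F => f p.1 p.2)) (x, y) :=
    ((ContDiffOn.fderiv_of_isOpen hf hO (m := ∞) (by simp)).contDiffAt
      (hO.mem_nhds h)).differentiableAt (by simp)
  have key : ∀ v w : E × F, dirDeriv v (dirDeriv w f) x y
      = fderiv ℝ (fderiv ℝ (fun p : E × F => f p.1 p.2)) (x, y) v w := by
    intro v w
    have := (hd.hasFDerivAt.clm_apply (hasFDerivAt_const w (x, y))).fderiv
    have h2 : fderiv ℝ (fun p : E × F => dirDeriv w f p.1 p.2) (x, y) = _ := this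
    change fderiv ℝ (fun p : E × F => dirDeriv w f p.1 p.2) (x, y) v = _
    rw [h2]
    simp
  rw [key, key, hs.eq]

theorem hasDerivAt_add_smul (x a : E) : HasDerivAt (fun t : ℝ => x + t • a) a 0 := by
  simpa using ((hasDerivAt_id (0 : ℝ)).smul_const a).const_add x

theorem JointlySmoothOn.hasDerivAt_line (hf : JointlySmoothOn f O) (hO : IsOpen O)
    (h : (x, y) ∈ O) (a : E) (b : F) :
    HasDerivAt (fun t : ℝ => f (x + t • a) (y + t • b)) (Finsler.dirDeriv (a, b) f x y) 0 := by
  have := hf.hasDerivAt_comp hO (hasDerivAt_add_smul x a) (hasDerivAt_add_smul y b)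
    (by simpa using h)
  simpa using this

/-- A directional derivative may be read off from the derivative of a function that agrees with
`f` near the point, along a straight line. -/
theorem dirDeriv_eq_of_hasDerivAt (hf : JointlySmoothOn f O) (hO : IsOpen O)
    (h : ∀ x y, (x, y) ∈ O → f x y = g x y) (hxy : (x, y) ∈ O) {a : E} {b : F} {m : ℝ}
    (hm : HasDerivAt (fun t : ℝ => g (x + t • a) (y + t • b)) m 0) :
    dirDeriv (a, b) f x y = m := by
  have hev : (fun t : ℝ => f (x + t • a) (y + t • b)) =ᶠ[nhds 0]
      fun t => g (x + t • a) (y + t • b) := by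
    have : ∀ᶠ t : ℝ in nhds 0, (x + t • a, y + t • b) ∈ O :=
      ((hasDerivAt_add_smul x a).continuousAt.prodMk
        (hasDerivAt_add_smul y b).continuousAt).eventually_mem (hO.mem_nhds (by simpa using hxy))
    filter_upwards [this] with t ht using h _ _ ht
  exact ((hm.congr_of_eventuallyEq hev).unique (hf.hasDerivAt_line hO hxy a b)).symm

end Calculus

/-! ### Partial derivatives of functions of a point and a tangent vector -/

section TangentCalculus

variable {n : ℕ}

variable {f : EuclideanSpace ℝ (Fin n) → EuclideanSpace ℝ (Fin n) → ℝ}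
  {O : Set (EuclideanSpace ℝ (Fin n) × EuclideanSpace ℝ (Fin n))} {x y : EuclideanSpace ℝ (Fin n)}

theorem pdx_eq_dirDeriv (hf : JointlySmoothOn f O) (hO : IsOpen O) (h : (x, y) ∈ O) (k : Fin n) :
    pdx k f x y = dirDeriv (EuclideanSpace.single k (1 : ℝ), 0) f x y :=
  fderiv_fst_eq_dirDeriv hf hO h _

theorem pdy_eq_dirDeriv (hf : JointlySmoothOn f O) (hO : IsOpen O) (h : (x, y) ∈ O) (k : Fin n) :
    pdy k f x y = dirDeriv (0, EuclideanSpace.single k (1 : ℝ)) f x y :=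
  fderiv_snd_eq_dirDeriv hf hO h _

theorem JointlySmoothOn.pdx (hf : JointlySmoothOn f O) (hO : IsOpen O) (k : Fin n) :
    JointlySmoothOn (pdx k f) O :=
  (hf.dirDeriv hO _).congr fun _ _ h => pdx_eq_dirDeriv hf hO h k

theorem JointlySmoothOn.pdy (hf : JointlySmoothOn f O) (hO : IsOpen O) (k : Fin n) :
    JointlySmoothOn (pdy k f) O :=
  (hf.dirDeriv hO _).congr fun _ _ h => pdy_eq_dirDeriv hf hO h k

theorem pdy_comm (hf : JointlySmoothOn f O) (hO : IsOpen O) (h : (x, y) ∈ O) (k l : Fin n) :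
    pdy k (pdy l f) x y = pdy l (pdy k f) x y := by
  rw [pdy_eq_dirDeriv (hf.pdy hO l) hO h, pdy_eq_dirDeriv (hf.pdy hO k) hO h,
    dirDeriv_congr hO (fun _ _ h => pdy_eq_dirDeriv hf hO h l) h,
    dirDeriv_congr hO (fun _ _ h => pdy_eq_dirDeriv hf hO h k) h, dirDeriv_comm hf hO h]

theorem dirDeriv_eq_sum (f : EuclideanSpace ℝ (Fin n) → EuclideanSpace ℝ (Fin n) → ℝ)
    (x y a b : EuclideanSpace ℝ (Fin n)) :
    dirDeriv (a, b) f x y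
      = ∑ k, a k * dirDeriv (EuclideanSpace.single k (1 : ℝ), 0) f x y
        + ∑ k, b k * dirDeriv (0, EuclideanSpace.single k (1 : ℝ)) f x y := by
  have hs : ∀ a : EuclideanSpace ℝ (Fin n), a = ∑ k, a k • EuclideanSpace.single k (1 : ℝ) := by
    intro a
    ext j
    simp [Finset.sum_apply, Pi.single_apply]
  have h1 : ((a, b) : EuclideanSpace ℝ (Fin n) × EuclideanSpace ℝ (Fin n)) =
      ∑ k, a k • ((EuclideanSpace.single k (1 : ℝ), 0) : EuclideanSpace ℝ (Fin n) × EuclideanSpace ℝ (Fin n))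
      + ∑ k, b k • ((0, EuclideanSpace.single k (1 : ℝ)) :
        EuclideanSpace ℝ (Fin n) × EuclideanSpace ℝ (Fin n)) := by
    ext1
    · simpa [Prod.fst_sum] using hs a
    · simpa [Prod.snd_sum] using hs b
  unfold dirDeriv
  conv_lhs => rw [h1]
  simp only [map_add, map_sum, map_smul, smul_eq_mul]

theorem dirDeriv_eq_sum_partials (hf : JointlySmoothOn f O) (hO : IsOpen O) (h : (x, y) ∈ O)
    (a b : EuclideanSpace ℝ (Fin n)) :
    dirDeriv (a, b) f x y = ∑ k, a k * pdx k f x y + ∑ k, b k * pdy k f x y := by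
  rw [dirDeriv_eq_sum]
  simp only [pdx_eq_dirDeriv hf hO h, pdy_eq_dirDeriv hf hO h]

end TangentCalculus

/-! ### Partial derivatives of functions of two real variables -/

section ScalarCalculus

variable {h : ℝ → ℝ → ℝ} {W : Set (ℝ × ℝ)} {r s : ℝ}

theorem pdr_eq_dirDeriv (hh : JointlySmoothOn h W) (hW : IsOpen W) (hrs : (r, s) ∈ W) :
    pdr h r s = dirDeriv (1, 0) h r s :=
  fderiv_fst_eq_dirDeriv hh hW hrs 1

theorem pds_eq_dirDeriv (hh : JointlySmoothOn h W) (hW : IsOpen W) (hrs : (r, s) ∈ W) :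
    pds h r s = dirDeriv (0, 1) h r s :=
  fderiv_snd_eq_dirDeriv hh hW hrs 1

theorem JointlySmoothOn.pdr (hh : JointlySmoothOn h W) (hW : IsOpen W) :
    JointlySmoothOn (pdr h) W :=
  (hh.dirDeriv hW _).congr fun _ _ hrs => pdr_eq_dirDeriv hh hW hrs

theorem JointlySmoothOn.pds (hh : JointlySmoothOn h W) (hW : IsOpen W) :
    JointlySmoothOn (pds h) W :=
  (hh.dirDeriv hW _).congr fun _ _ hrs => pds_eq_dirDeriv hh hW hrs

theorem pdr_pds_comm (hh : JointlySmoothOn h W) (hW : IsOpen W) (hrs : (r, s) ∈ W) :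
    pdr (pds h) r s = pds (pdr h) r s := by
  rw [pdr_eq_dirDeriv (hh.pds hW) hW hrs, pds_eq_dirDeriv (hh.pdr hW) hW hrs,
    dirDeriv_congr hW (fun _ _ h => pds_eq_dirDeriv hh hW h) hrs,
    dirDeriv_congr hW (fun _ _ h => pdr_eq_dirDeriv hh hW h) hrs, dirDeriv_comm hh hW hrs]

theorem JointlySmoothOn.hasDerivAt_comp_real (hh : JointlySmoothOn h W) (hW : IsOpen W)
    {c d : ℝ → ℝ} {a b t : ℝ} (hc : HasDerivAt c a t) (hd : HasDerivAt d b t)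
    (hrs : (c t, d t) ∈ W) :
    HasDerivAt (fun τ => h (c τ) (d τ))
      (a * Finsler.pdr h (c t) (d t) + b * Finsler.pds h (c t) (d t)) t := by
  convert hh.hasDerivAt_comp hW hc hd hrs using 1
  rw [pdr_eq_dirDeriv hh hW hrs, pds_eq_dirDeriv hh hW hrs]
  have : ((a, b) : ℝ × ℝ) = a • ((1, 0) : ℝ × ℝ) + b • ((0, 1) : ℝ × ℝ) := by simp
  unfold Finsler.dirDeriv
  rw [this]
  simp only [map_add, map_smul, smul_eq_mul]

theorem JointlySmoothOn.hasDerivAt_fst (hh : JointlySmoothOn h W) (hW : IsOpen W)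
    (hrs : (r, s) ∈ W) : HasDerivAt (fun t => h t s) (Finsler.pdr h r s) r := by
  simpa using hh.hasDerivAt_comp_real hW (hasDerivAt_id r) (hasDerivAt_const r s) hrs

theorem JointlySmoothOn.hasDerivAt_snd (hh : JointlySmoothOn h W) (hW : IsOpen W)
    (hrs : (r, s) ∈ W) : HasDerivAt (fun t => h r t) (Finsler.pds h r s) s := by
  simpa using hh.hasDerivAt_comp_real hW (hasDerivAt_const s r) (hasDerivAt_id s) hrs

end ScalarCalculus

/-! ### The Riemann curvature of a spray -/

section Spray

variable {n : ℕ} {O : Set (EuclideanSpace ℝ (Fin n) × EuclideanSpace ℝ (Fin n))}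
  {x y : EuclideanSpace ℝ (Fin n)}

theorem hasDerivAt_line_apply (y b : EuclideanSpace ℝ (Fin n)) (k : Fin n) :
    HasDerivAt (fun t : ℝ => (y + t • b) k) (b k) 0 := by
  have := ((hasDerivAt_id (0 : ℝ)).mul_const (b k)).const_add (y k)
  simpa using this

/-- Differentiation of a relation `y^l f_l = c g`, such as Euler's relation. -/
theorem dirDeriv_sum_mul {f : Fin n → EuclideanSpace ℝ (Fin n) → EuclideanSpace ℝ (Fin n) → ℝ}
    {g : EuclideanSpace ℝ (Fin n) → EuclideanSpace ℝ (Fin n) → ℝ} {c : ℝ}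
    (hO : IsOpen O) (hf : ∀ l, JointlySmoothOn (f l) O) (hg : JointlySmoothOn g O)
    (h : ∀ x y, (x, y) ∈ O → ∑ l, y l * f l x y = c * g x y) (hxy : (x, y) ∈ O)
    (a b : EuclideanSpace ℝ (Fin n)) :
    ∑ l, b l * f l x y + ∑ l, y l * dirDeriv (a, b) (f l) x y = c * dirDeriv (a, b) g x y := by
  have hg' : JointlySmoothOn (fun x y => c * g x y) O := contDiffOn_const.mul hg
  have h1 := (hg.hasDerivAt_line hO hxy a b).const_mul c
  have h2 := dirDeriv_eq_of_hasDerivAt hg' hO (fun _ _ _ => rfl) hxy h1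
  have h3 : HasDerivAt (fun t : ℝ => ∑ l, (y + t • b) l * f l (x + t • a) (y + t • b))
      (∑ l, (b l * f l x y + y l * dirDeriv (a, b) (f l) x y)) 0 := by
    apply HasDerivAt.fun_sum
    intro l _
    exact ((hasDerivAt_line_apply y b l).fun_mul
      ((hf l).hasDerivAt_line hO hxy a b)).congr_deriv (by simp)
  rw [← Finset.sum_add_distrib, ← h2]
  exact (dirDeriv_eq_of_hasDerivAt hg' hO (fun x y hxy => (h x y hxy).symm) hxy h3).symm

theorem pdx_sum_mul {f : Fin n → EuclideanSpace ℝ (Fin n) → EuclideanSpace ℝ (Fin n) → ℝ}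
    {g : EuclideanSpace ℝ (Fin n) → EuclideanSpace ℝ (Fin n) → ℝ} {c : ℝ}
    (hO : IsOpen O) (hf : ∀ l, JointlySmoothOn (f l) O) (hg : JointlySmoothOn g O)
    (h : ∀ x y, (x, y) ∈ O → ∑ l, y l * f l x y = c * g x y) (hxy : (x, y) ∈ O) (k : Fin n) :
    ∑ l, y l * pdx k (f l) x y = c * pdx k g x y := by
  have := dirDeriv_sum_mul hO hf hg h hxy (EuclideanSpace.single k 1) 0
  simp only [pdx_eq_dirDeriv (hf _) hO hxy, pdx_eq_dirDeriv hg hO hxy]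
  simpa using this

theorem pdy_sum_mul {f : Fin n → EuclideanSpace ℝ (Fin n) → EuclideanSpace ℝ (Fin n) → ℝ}
    {g : EuclideanSpace ℝ (Fin n) → EuclideanSpace ℝ (Fin n) → ℝ} {c : ℝ}
    (hO : IsOpen O) (hf : ∀ l, JointlySmoothOn (f l) O) (hg : JointlySmoothOn g O)
    (h : ∀ x y, (x, y) ∈ O → ∑ l, y l * f l x y = c * g x y) (hxy : (x, y) ∈ O) (k : Fin n) :
    f k x y + ∑ l, y l * pdy k (f l) x y = c * pdy k g x y := by
  have := dirDeriv_sum_mul hO hf hg h hxy 0 (EuclideanSpace.single k 1)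
  simp only [pdy_eq_dirDeriv (hf _) hO hxy, pdy_eq_dirDeriv hg hO hxy]
  simpa [Pi.single_apply] using this

/-- Contracted with `y` twice, the Berwald curvature collapses, by Euler's relation for the spray
coefficients, to `2 ∂G^i/∂x^k - S(N^i_k) - N^i_m N^m_k`, where `S = y^l ∂/∂x^l - 2 G^l ∂/∂y^l` is
the spray itself. -/
theorem riemannCurvature_eq_spray {F : EuclideanSpace ℝ (Fin n) → EuclideanSpace ℝ (Fin n) → ℝ}
    (hO : IsOpen O) (hG : ∀ i, JointlySmoothOn (sprayCoeff F i) O)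
    (hE : ∀ i x y, (x, y) ∈ O → ∑ k, y k * pdy k (sprayCoeff F i) x y = 2 * sprayCoeff F i x y)
    (hxy : (x, y) ∈ O) (i k : Fin n) :
    riemannCurvature F i k x y =
      2 * pdx k (sprayCoeff F i) x y
        - dirDeriv (y, WithLp.toLp 2 fun l => -2 * sprayCoeff F l x y)
            (nonlinearConnection F i k) x y
        - ∑ m, nonlinearConnection F i m x y * nonlinearConnection F m k x y := by
  have hN : ∀ i k, JointlySmoothOn (pdy k (sprayCoeff F i)) O := fun i k => (hG i).pdy hO k
  have hΓ : ∀ i j k, JointlySmoothOn (pdy j (pdy k (sprayCoeff F i))) O :=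
    fun i j k => (hN i k).pdy hO j
  have e2 : ∀ i j x y, (x, y) ∈ O →
      ∑ l, y l * pdy j (pdy l (sprayCoeff F i)) x y = 1 * pdy j (sprayCoeff F i) x y := by
    intro i j x y h
    have := pdy_sum_mul hO (hN i) (hG i) (hE i) h j
    linarith
  have e2' : ∀ i k x y, (x, y) ∈ O →
      ∑ j, y j * pdy j (pdy k (sprayCoeff F i)) x y = 1 * pdy k (sprayCoeff F i) x y := by
    intro i k x y h
    rw [← e2 i k x y h]
    exact Finset.sum_congr rfl fun j _ => by rw [pdy_comm (hG i) hO h]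
  have e3 : ∀ i m j, ∑ l, y l * pdy m (pdy j (pdy l (sprayCoeff F i))) x y = 0 := by
    intro i m j
    have := pdy_sum_mul hO (hΓ i j) (hN i j) (e2 i j) hxy m
    rw [pdy_comm (hG i) hO hxy j m] at this
    linarith
  have e3' : ∀ i m k, ∑ j, y j * pdy m (pdy j (pdy k (sprayCoeff F i))) x y = 0 := by
    intro i m k
    have := pdy_sum_mul hO (fun j => hΓ i j k) (hN i k) (e2' i k) hxy m
    linarith
  have e4 : ∑ j, y j * ∑ l, y l * pdx k (pdy j (pdy l (sprayCoeff F i))) x y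
      = 2 * pdx k (sprayCoeff F i) x y := by
    rw [← pdx_sum_mul hO (hN i) (hG i) (hE i) hxy k]
    refine Finset.sum_congr rfl fun j _ => ?_
    rw [pdx_sum_mul hO (hΓ i j) (hN i j) (e2 i j) hxy k, one_mul]
  have e5 : ∀ l, ∑ j, y j * pdx l (pdy j (pdy k (sprayCoeff F i))) x y
      = pdx l (pdy k (sprayCoeff F i)) x y := by
    intro l
    rw [pdx_sum_mul hO (fun j => hΓ i j k) (hN i k) (e2' i k) hxy l, one_mul]
  have t2 : ∑ j, ∑ l, (∑ m, nonlinearConnection F m k x y *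
      pdy m (pdy j (pdy l (sprayCoeff F i))) x y) * y j * y l = 0 := by
    refine Finset.sum_eq_zero fun j _ => ?_
    calc _ = ∑ m, nonlinearConnection F m k x y * y j *
          ∑ l, y l * pdy m (pdy j (pdy l (sprayCoeff F i))) x y := by
            simp only [Finset.sum_mul, Finset.mul_sum]
            rw [Finset.sum_comm]
            exact Finset.sum_congr rfl fun _ _ => Finset.sum_congr rfl fun _ _ => by ring
      _ = 0 := by simp [e3]
  have t4 : ∑ j, ∑ l, (∑ m, nonlinearConnection F m l x y *
      pdy m (pdy j (pdy k (sprayCoeff F i))) x y) * y j * y l = 0 := by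
    rw [Finset.sum_comm]
    refine Finset.sum_eq_zero fun l _ => ?_
    calc _ = ∑ m, nonlinearConnection F m l x y * y l *
          ∑ j, y j * pdy m (pdy j (pdy k (sprayCoeff F i))) x y := by
            simp only [Finset.sum_mul, Finset.mul_sum]
            rw [Finset.sum_comm]
            exact Finset.sum_congr rfl fun _ _ => Finset.sum_congr rfl fun _ _ => by ring
      _ = 0 := by simp [e3']
  have t1 : ∑ j, ∑ l, pdx k (pdy j (pdy l (sprayCoeff F i))) x y * y j * y l
      = 2 * pdx k (sprayCoeff F i) x y := by
    rw [← e4]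
    simp only [Finset.mul_sum]
    exact Finset.sum_congr rfl fun _ _ => Finset.sum_congr rfl fun _ _ => by ring
  have t3 : ∑ j, ∑ l, pdx l (pdy j (pdy k (sprayCoeff F i))) x y * y j * y l
      = ∑ l, y l * pdx l (pdy k (sprayCoeff F i)) x y := by
    simp only [← e5, Finset.mul_sum]
    rw [Finset.sum_comm]
    exact Finset.sum_congr rfl fun _ _ => Finset.sum_congr rfl fun _ _ => by ring
  have t5 : ∑ j, ∑ l, (∑ m, pdy k (pdy m (sprayCoeff F i)) x y *
      pdy j (pdy l (sprayCoeff F m)) x y) * y j * y l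
      = ∑ m, 2 * sprayCoeff F m x y * pdy m (pdy k (sprayCoeff F i)) x y := by
    calc _ = ∑ m, pdy m (pdy k (sprayCoeff F i)) x y *
          ∑ j, y j * ∑ l, y l * pdy j (pdy l (sprayCoeff F m)) x y := by
            simp only [Finset.sum_mul, Finset.mul_sum, pdy_comm (hG i) hO hxy k]
            rw [Finset.sum_congr rfl fun j _ => Finset.sum_comm, Finset.sum_comm]
            exact Finset.sum_congr rfl fun _ _ => Finset.sum_congr rfl fun _ _ =>
              Finset.sum_congr rfl fun _ _ => by ring
      _ = _ := by
            refine Finset.sum_congr rfl fun m _ => ?_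
            simp only [e2 m _ x y hxy, one_mul, hE m x y hxy]
            ring
  have t6 : ∑ j, ∑ l, (∑ m, pdy l (pdy m (sprayCoeff F i)) x y *
      pdy j (pdy k (sprayCoeff F m)) x y) * y j * y l
      = ∑ m, nonlinearConnection F i m x y * nonlinearConnection F m k x y := by
    calc _ = ∑ m, (∑ l, y l * pdy l (pdy m (sprayCoeff F i)) x y) *
          ∑ j, y j * pdy j (pdy k (sprayCoeff F m)) x y := by
            simp only [Finset.sum_mul, Finset.mul_sum]
            rw [Finset.sum_congr rfl fun j _ => Finset.sum_comm, Finset.sum_comm]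
            exact Finset.sum_congr rfl fun _ _ => Finset.sum_congr rfl fun _ _ =>
              Finset.sum_congr rfl fun _ _ => by ring
      _ = _ := by
            refine Finset.sum_congr rfl fun m _ => ?_
            simp only [e2' _ _ x y hxy, one_mul]
            rfl
  have hS : dirDeriv (y, WithLp.toLp 2 fun l => -2 * sprayCoeff F l x y)
      (nonlinearConnection F i k) x y
      = ∑ l, y l * pdx l (pdy k (sprayCoeff F i)) x y
        - ∑ m, 2 * sprayCoeff F m x y * pdy m (pdy k (sprayCoeff F i)) x y := by
    rw [dirDeriv_eq_sum_partials (show JointlySmoothOn (nonlinearConnection F i k) O from hN i k)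
      hO hxy, sub_eq_add_neg, ← Finset.sum_neg_distrib]
    congr 1
    exact Finset.sum_congr rfl fun _ _ => by simp [nonlinearConnection]
  have expand : riemannCurvature F i k x y
      = (∑ j, ∑ l, pdx k (pdy j (pdy l (sprayCoeff F i))) x y * y j * y l)
        - (∑ j, ∑ l, (∑ m, nonlinearConnection F m k x y *
            pdy m (pdy j (pdy l (sprayCoeff F i))) x y) * y j * y l)
        - (∑ j, ∑ l, pdx l (pdy j (pdy k (sprayCoeff F i))) x y * y j * y l)
        + (∑ j, ∑ l, (∑ m, nonlinearConnection F m l x y *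
            pdy m (pdy j (pdy k (sprayCoeff F i))) x y) * y j * y l)
        + (∑ j, ∑ l, (∑ m, pdy k (pdy m (sprayCoeff F i)) x y *
            pdy j (pdy l (sprayCoeff F m)) x y) * y j * y l)
        - ∑ j, ∑ l, (∑ m, pdy l (pdy m (sprayCoeff F i)) x y *
            pdy j (pdy k (sprayCoeff F m)) x y) * y j * y l := by
    simp only [← Finset.sum_add_distrib, ← Finset.sum_sub_distrib]
    refine Finset.sum_congr rfl fun j _ => Finset.sum_congr rfl fun l _ => ?_
    simp only [berwaldCurvature, horizontalDeriv, berwaldConnection, Finset.sum_sub_distrib]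
    ring
  rw [expand, t1, t2, t3, t4, t5, t6, hS]
  ring

end Spray

/-! ### Smoothness of the spray and of the curvature of a Finsler metric -/

section Smoothness

variable {n : ℕ} {U : Set (EuclideanSpace ℝ (Fin n))}
  {F : EuclideanSpace ℝ (Fin n) → EuclideanSpace ℝ (Fin n) → ℝ}

theorem contDiffOn_det {X ι : Type*} [NormedAddCommGroup X] [NormedSpace ℝ X] [Fintype ι]
    [DecidableEq ι] {O : Set X} {A : X → Matrix ι ι ℝ}
    (hA : ∀ i j, ContDiffOn ℝ ∞ (fun p => A p i j) O) :
    ContDiffOn ℝ ∞ (fun p => (A p).det) O := by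
  simp only [Matrix.det_apply]
  refine ContDiffOn.sum fun σ _ => ContDiffOn.const_smul _ ?_
  exact contDiffOn_prod fun i _ => hA _ _

theorem contDiffOn_matrix_inv {X ι : Type*} [NormedAddCommGroup X] [NormedSpace ℝ X] [Fintype ι]
    [DecidableEq ι] {O : Set X} {A : X → Matrix ι ι ℝ}
    (hA : ∀ i j, ContDiffOn ℝ ∞ (fun p => A p i j) O) (hdet : ∀ p ∈ O, (A p).det ≠ 0) (i j : ι) :
    ContDiffOn ℝ ∞ (fun p => (A p)⁻¹ i j) O := by
  have h : ∀ p, (A p)⁻¹ i j = (A p).det⁻¹ * ((A p).updateRow j (Pi.single i 1)).det := by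
    intro p
    rw [Matrix.inv_def, Matrix.smul_apply, Matrix.adjugate_apply, Ring.inverse_eq_inv', smul_eq_mul]
  simp only [h]
  refine ((contDiffOn_det hA).inv hdet).mul (contDiffOn_det fun k l => ?_)
  simp only [Matrix.updateRow_apply]
  split_ifs
  · exact contDiffOn_const
  · exact hA k l

theorem contDiff_snd_apply (k : Fin n) : ContDiff ℝ ∞
    (fun p : EuclideanSpace ℝ (Fin n) × EuclideanSpace ℝ (Fin n) => p.2 k) := by
  fun_prop

theorem isOpen_prod_compl_zero (hU : IsOpen U) :
    IsOpen (U ×ˢ ({0}ᶜ : Set (EuclideanSpace ℝ (Fin n)))) :=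
  hU.prod isOpen_compl_singleton

namespace IsFinslerMetricOn

theorem sq_smooth (hF : IsFinslerMetricOn U F) :
    JointlySmoothOn (fun x y => F x y ^ 2) (U ×ˢ {0}ᶜ) :=
  ContDiffOn.pow hF.smooth 2

theorem det_ne_zero (hF : IsFinslerMetricOn U F) {x y : EuclideanSpace ℝ (Fin n)} (hx : x ∈ U)
    (hy : y ≠ 0) : (fundamentalTensor F x y).det ≠ 0 :=
  (hF.posDef x hx y hy).det_pos.ne'

theorem fundamentalTensor_smooth (hF : IsFinslerMetricOn U F) (hU : IsOpen U) (i j : Fin n) :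
    JointlySmoothOn (fun x y => fundamentalTensor F x y i j) (U ×ˢ {0}ᶜ) := by
  have hO := isOpen_prod_compl_zero hU
  exact contDiffOn_const.mul ((hF.sq_smooth.pdy hO j).pdy hO i)

theorem sprayCoeff_smooth (hF : IsFinslerMetricOn U F) (hU : IsOpen U) (i : Fin n) :
    JointlySmoothOn (sprayCoeff F i) (U ×ˢ {0}ᶜ) := by
  have hO := isOpen_prod_compl_zero hU
  refine contDiffOn_const.mul (ContDiffOn.sum fun l _ => ContDiffOn.mul ?_ (ContDiffOn.sub ?_ ?_))
  · exact contDiffOn_matrix_inv (fun i j => hF.fundamentalTensor_smooth hU i j)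
      (fun p hp => hF.det_ne_zero hp.1 hp.2) i l
  · exact ContDiffOn.sum fun k _ => ContDiffOn.mul ((hF.sq_smooth.pdy hO l).pdx hO k)
      (contDiff_snd_apply k).contDiffOn
  · exact hF.sq_smooth.pdx hO l

theorem riemannCurvature_smooth (hF : IsFinslerMetricOn U F) (hU : IsOpen U) (i k : Fin n) :
    JointlySmoothOn (riemannCurvature F i k) (U ×ˢ {0}ᶜ) := by
  have hO := isOpen_prod_compl_zero hU
  have hG := hF.sprayCoeff_smooth hU
  have hΓ : ∀ i j k, JointlySmoothOn (berwaldConnection F i j k) (U ×ˢ {0}ᶜ) :=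
    fun i j k => ((hG i).pdy hO k).pdy hO j
  have hδ : ∀ k {f : EuclideanSpace ℝ (Fin n) → EuclideanSpace ℝ (Fin n) → ℝ},
      JointlySmoothOn f (U ×ˢ {0}ᶜ) → JointlySmoothOn (horizontalDeriv F k f) (U ×ˢ {0}ᶜ) :=
    fun k f hf => ContDiffOn.sub (hf.pdx hO k)
      (ContDiffOn.sum fun m _ => ContDiffOn.mul ((hG m).pdy hO k) (hf.pdy hO m))
  refine ContDiffOn.sum fun j _ => ContDiffOn.sum fun l _ => ContDiffOn.mul (ContDiffOn.mul ?_
    (contDiff_snd_apply j).contDiffOn) (contDiff_snd_apply l).contDiffOn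
  exact ((hδ k (hΓ i j l)).sub (hδ l (hΓ i j k))).add (ContDiffOn.sum fun m _ =>
    ((hΓ i k m).mul (hΓ m j l)).sub ((hΓ i l m).mul (hΓ m j k)))

/-- By continuity, the equation of constant flag curvature has to be checked only away from the
origin, where `|x|` is smooth. -/
theorem hasConstantFlagCurvatureOn_of_ne_zero (hF : IsFinslerMetricOn U F) (hU : IsOpen U) {K : ℝ}
    (h : ∀ x ∈ U, x ≠ 0 → ∀ y, y ≠ 0 → ∀ i k : Fin n,
      riemannCurvature F i k x y =
        K * (F x y ^ 2 * (if i = k then 1 else 0)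
          - (∑ l, fundamentalTensor F x y k l * y l) * y i)) :
    HasConstantFlagCurvatureOn U F K := by
  intro x hx y hy i k
  by_cases hx0 : x = 0
  swap
  · exact h x hx hx0 y hy i k
  subst hx0
  have hO := isOpen_prod_compl_zero hU
  have hL := hF.riemannCurvature_smooth hU i k
  have hR : ContDiffOn ℝ ∞
      (fun p : EuclideanSpace ℝ (Fin n) × EuclideanSpace ℝ (Fin n) =>
        K * (F p.1 p.2 ^ 2 * (if i = k then 1 else 0)
          - (∑ l, fundamentalTensor F p.1 p.2 k l * p.2 l) * p.2 i)) (U ×ˢ {0}ᶜ) :=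
    contDiffOn_const.mul ((hF.sq_smooth.mul contDiffOn_const).sub
      ((ContDiffOn.sum fun l _ => ContDiffOn.mul (hF.fundamentalTensor_smooth hU k l)
        (contDiff_snd_apply l).contDiffOn).mul (contDiff_snd_apply i).contDiffOn))
  have hmem : ((0 : EuclideanSpace ℝ (Fin n)), y) ∈ U ×ˢ ({0}ᶜ : Set (EuclideanSpace ℝ (Fin n))) :=
    ⟨hx, hy⟩
  have hc : Filter.Tendsto (fun t : ℝ => (t • y, y)) (nhdsWithin 0 {0}ᶜ)
      (nhds ((0 : EuclideanSpace ℝ (Fin n)), y)) := by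
    have : Continuous fun t : ℝ => (t • y, y) := by fun_prop
    have h2 := this.tendsto 0
    rw [zero_smul] at h2
    exact h2.mono_left nhdsWithin_le_nhds
  have h1 := (hL.continuousOn.continuousAt (hO.mem_nhds hmem)).tendsto.comp hc
  have h2 := (hR.continuousOn.continuousAt (hO.mem_nhds hmem)).tendsto.comp hc
  refine tendsto_nhds_unique_of_eventuallyEq h1 h2 ?_
  filter_upwards [hc.eventually_mem (hO.mem_nhds hmem), self_mem_nhdsWithin] with t ht ht0
  exact h (t • y) ht.1 (smul_ne_zero ht0 hy) y hy i k

theorem sprayCoeff_eq (hF : IsFinslerMetricOn U F) {x y : EuclideanSpace ℝ (Fin n)} (hx : x ∈ U)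
    (hy : y ≠ 0) (V : Fin n → ℝ)
    (hV : ∀ l, ∑ i, fundamentalTensor F x y l i * (4 * V i)
      = ∑ k, pdx k (pdy l (fun u v => F u v ^ 2)) x y * y k - pdx l (fun u v => F u v ^ 2) x y)
    (i : Fin n) : sprayCoeff F i x y = V i := by
  have h1 : (fundamentalTensor F x y).mulVec (fun i => 4 * V i) = fun l =>
      ∑ k, pdx k (pdy l (fun u v => F u v ^ 2)) x y * y k - pdx l (fun u v => F u v ^ 2) x y :=
    funext hV
  have h2 : (fundamentalTensor F x y)⁻¹.mulVec (fun l =>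
      ∑ k, pdx k (pdy l (fun u v => F u v ^ 2)) x y * y k - pdx l (fun u v => F u v ^ 2) x y)
      = fun i => 4 * V i := by
    rw [← h1, Matrix.mulVec_mulVec, Matrix.nonsing_inv_mul _
      (hF.det_ne_zero hx hy).isUnit, Matrix.one_mulVec]
  have h3 := congrFun h2 i
  simp only [Matrix.mulVec, dotProduct] at h3
  rw [sprayCoeff, h3]
  ring

end IsFinslerMetricOn

end Smoothness

/-! ### The scalar functions of a spherically symmetric metric -/

section ScalarFunctions

/-- The denominator `φ - s φ_s + (r² - s²) φ_{ss}` of `Q`. -/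
def scalarDen (φ : ℝ → ℝ → ℝ) (r s : ℝ) : ℝ :=
  φ r s - s * pds φ r s + (r ^ 2 - s ^ 2) * pds (pds φ) r s

/-- The open rectangle `0 < r < ρ`, `|s| < ρ`. -/
def rectangle (ρ : ℝ) : Set (ℝ × ℝ) := Set.Ioo 0 ρ ×ˢ Set.Ioo (-ρ) ρ

/-- The part of the open rectangle `0 < r < ρ`, `|s| < ρ` on which `φ` and the denominator of `Q`
are positive, so that `P` and `Q` are smooth. It is open, and contains all `(r, s)` with
`0 < r < ρ` and `|s| ≤ r`. -/
def regularSet (φ : ℝ → ℝ → ℝ) (ρ : ℝ) : Set (ℝ × ℝ) :=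
  {p ∈ rectangle ρ | 0 < φ p.1 p.2 ∧ 0 < scalarDen φ p.1 p.2}

variable {φ : ℝ → ℝ → ℝ} {ρ r s : ℝ}

theorem isOpen_rectangle : IsOpen (rectangle ρ) := isOpen_Ioo.prod isOpen_Ioo

theorem regularSet_subset : regularSet φ ρ ⊆ rectangle ρ := fun _ h => h.1

theorem contDiff_fst_real : ContDiff ℝ ∞ (fun p : ℝ × ℝ => p.1) := contDiff_fst

theorem contDiff_snd_real : ContDiff ℝ ∞ (fun p : ℝ × ℝ => p.2) := contDiff_snd

theorem scalarDen_smooth (hφ : JointlySmoothOn φ (rectangle ρ)) :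
    JointlySmoothOn (scalarDen φ) (rectangle ρ) := by
  have hW := isOpen_rectangle (ρ := ρ)
  have h1 := contDiff_fst_real.contDiffOn (s := rectangle ρ)
  have h2 := contDiff_snd_real.contDiffOn (s := rectangle ρ)
  exact (hφ.sub (h2.mul (hφ.pds hW))).add (((h1.pow 2).sub (h2.pow 2)).mul ((hφ.pds hW).pds hW))

theorem isOpen_regularSet (hφ : JointlySmoothOn φ (rectangle ρ)) : IsOpen (regularSet φ ρ) := by
  have h1 := hφ.continuousOn.isOpen_inter_preimage isOpen_rectangle (isOpen_Ioi (a := (0 : ℝ)))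
  have h2 := (scalarDen_smooth hφ).continuousOn.isOpen_inter_preimage isOpen_rectangle
    (isOpen_Ioi (a := (0 : ℝ)))
  convert h1.inter h2 using 1
  ext p
  simp only [regularSet, Set.mem_ofPred_eq, Set.mem_inter_iff, Set.mem_preimage, Set.mem_Ioi]
  tauto

theorem scalarQ_smooth (hφ : JointlySmoothOn φ (rectangle ρ)) :
    JointlySmoothOn (scalarQ φ) (regularSet φ ρ) := by
  have hW := isOpen_regularSet hφ
  have h1 := contDiff_fst_real.contDiffOn (s := regularSet φ ρ)
  have h2 := contDiff_snd_real.contDiffOn (s := regularSet φ ρ)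
  have hφ' := hφ.mono (regularSet_subset (φ := φ))
  have hr : ∀ p ∈ regularSet φ ρ, 2 * p.1 ≠ 0 := fun p hp => by
    have := hp.1.1.1
    positivity
  exact (contDiffOn_const.div (contDiffOn_const.mul h1) hr).mul
    ((((h2.mul ((hφ'.pdr hW).pds hW)).add (h1.mul ((hφ'.pds hW).pds hW))).sub (hφ'.pdr hW)).div
      ((scalarDen_smooth hφ).mono regularSet_subset) fun p hp => hp.2.2.ne')

theorem scalarP_smooth (hφ : JointlySmoothOn φ (rectangle ρ)) :
    JointlySmoothOn (scalarP φ) (regularSet φ ρ) := by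
  have hW := isOpen_regularSet hφ
  have h1 := contDiff_fst_real.contDiffOn (s := regularSet φ ρ)
  have h2 := contDiff_snd_real.contDiffOn (s := regularSet φ ρ)
  have hφ' := hφ.mono (regularSet_subset (φ := φ))
  have hr : ∀ p ∈ regularSet φ ρ, 2 * p.1 * φ p.1 p.2 ≠ 0 := fun p hp => by
    have := hp.1.1.1
    have := hp.2.1
    positivity
  exact ((contDiffOn_const.div ((contDiffOn_const.mul h1).mul hφ') hr).mul
    ((h2.mul (hφ'.pdr hW)).add (h1.mul (hφ'.pds hW)))).sub
    (((scalarQ_smooth hφ).div hφ' fun p hp => hp.2.1.ne').mul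
      ((h2.mul hφ').add (((h1.pow 2).sub (h2.pow 2)).mul (hφ'.pds hW))))

/-- The definition of `P`, as a transport equation for `φ` along the operator
`D = (s/r) ∂_r + (1 - 2 (r² - s²) Q) ∂_s`, the action of the spray on functions of `(r, s)` up to
the factor `|y|`. -/
theorem transport_phi (h : (r, s) ∈ regularSet φ ρ) :
    s / r * pdr φ r s + (1 - 2 * (r ^ 2 - s ^ 2) * scalarQ φ r s) * pds φ r s
      = 2 * φ r s * (scalarP φ r s + s * scalarQ φ r s) := by
  have hr : r ≠ 0 := h.1.1.1.ne'
  have hφ : φ r s ≠ 0 := h.2.1.ne'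
  unfold scalarP
  field_simp
  ring

/-- The definition of `Q`, as a transport equation for `φ_s`. -/
theorem transport_phi_s (hφ : JointlySmoothOn φ (rectangle ρ)) (h : (r, s) ∈ regularSet φ ρ) :
    s / r * pdr (pds φ) r s + (1 - 2 * (r ^ 2 - s ^ 2) * scalarQ φ r s) * pds (pds φ) r s
      = pdr φ r s / r + 2 * (φ r s - s * pds φ r s) * scalarQ φ r s := by
  have hr : r ≠ 0 := h.1.1.1.ne'
  have hden : φ r s - s * pds φ r s + (r ^ 2 - s ^ 2) * pds (pds φ) r s ≠ 0 := h.2.2.ne'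
  have hQ : scalarQ φ r s * (2 * r * (φ r s - s * pds φ r s + (r ^ 2 - s ^ 2) * pds (pds φ) r s))
      = s * pds (pdr φ) r s + r * pds (pds φ) r s - pdr φ r s := by
    unfold scalarQ
    generalize φ r s - s * pds φ r s + (r ^ 2 - s ^ 2) * pds (pds φ) r s = D at hden ⊢
    field_simp
  rw [pdr_pds_comm hφ isOpen_rectangle h.1]
  field_simp
  linear_combination -hQ

/-- The component of `∂F/∂x^k = N^m_k ∂F/∂y^m` along `x_k`. -/
theorem horizontal_phi (hφ : JointlySmoothOn φ (rectangle ρ)) (h : (r, s) ∈ regularSet φ ρ) :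
    pdr φ r s / r = pds φ r s * scalarP φ r s + φ r s * pds (scalarP φ) r s
      + (s * φ r s + (r ^ 2 - s ^ 2) * pds φ r s) * pds (scalarQ φ) r s := by
  have hW := isOpen_regularSet hφ
  have hφ' := hφ.mono (regularSet_subset (φ := φ))
  have dφ := hφ'.hasDerivAt_snd hW h
  have dφr := (hφ'.pdr hW).hasDerivAt_snd hW h
  have dφs := (hφ'.pds hW).hasDerivAt_snd hW h
  have dP := (scalarP_smooth hφ).hasDerivAt_snd hW h
  have dQ := (scalarQ_smooth hφ).hasDerivAt_snd hW h
  have ds := hasDerivAt_id s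
  have L := ((ds.div_const r).fun_mul dφr).fun_add
    ((((((ds.fun_pow 2).const_sub (r ^ 2)).const_mul 2).fun_mul dQ).const_sub 1).fun_mul dφs)
  have R := (dφ.const_mul 2).fun_mul (dP.fun_add (ds.fun_mul dQ))
  have hev : (fun t => t / r * pdr φ r t + (1 - 2 * (r ^ 2 - t ^ 2) * scalarQ φ r t) * pds φ r t)
      =ᶠ[nhds s] fun t => 2 * φ r t * (scalarP φ r t + t * scalarQ φ r t) := by
    have : Continuous fun t : ℝ => (r, t) := by fun_prop
    filter_upwards [this.continuousAt.eventually_mem (hW.mem_nhds h)] with t ht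
      using transport_phi ht
  have key := L.unique (R.congr_of_eventuallyEq hev)
  have hQ := transport_phi_s hφ h
  rw [pdr_pds_comm hφ isOpen_rectangle h.1] at hQ
  simp only [id] at key
  push_cast at key
  linear_combination (key - hQ) / 2

/-- The coefficient of `|y| y^i x_k` in the Riemann curvature. -/
def scalarR3 (φ : ℝ → ℝ → ℝ) (r s : ℝ) : ℝ :=
  2 * pdr (scalarP φ) r s / r - s / r * pdr (pds (scalarP φ)) r s
    - (1 - 2 * (r ^ 2 - s ^ 2) * scalarQ φ r s) * pds (pds (scalarP φ)) r s
    - scalarP φ r s * pds (scalarP φ) r s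
    + 2 * scalarQ φ r s * (scalarP φ r s - s * pds (scalarP φ) r s)
    - pds (scalarQ φ) r s * (1 + s * scalarP φ r s + (r ^ 2 - s ^ 2) * pds (scalarP φ) r s)

/-- The integrability condition of the system formed by `transport_phi` and `horizontal_phi`. It
is the scalar form of `∂F/∂y^i R^i_k = 0`, and expresses `R₃` through `R₁` and `R₂`. -/
theorem scalarR3_eq (hφ : JointlySmoothOn φ (rectangle ρ)) (h : (r, s) ∈ regularSet φ ρ) :
    φ r s * scalarR3 φ r s + pds φ r s * scalarR1 φ r s
      + (s * φ r s + (r ^ 2 - s ^ 2) * pds φ r s) * scalarR2 φ r s = 0 := by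
  have hW := isOpen_regularSet hφ
  have hφ' := hφ.mono (regularSet_subset (φ := φ))
  have hP := scalarP_smooth hφ
  have hQ := scalarQ_smooth hφ
  have hr : r ≠ 0 := h.1.1.1.ne'
  have hcr : Continuous fun t : ℝ => (t, s) := by fun_prop
  have hcs : Continuous fun t : ℝ => (r, t) := by fun_prop
  have dr := hasDerivAt_id r
  have ds := hasDerivAt_id s
  -- the derivative of `transport_phi` in `r`
  have key1 := (((((hasDerivAt_const r s).fun_div dr hr).fun_mul
      ((hφ'.pdr hW).hasDerivAt_fst hW h)).fun_add
      ((((((dr.fun_pow 2).sub_const (s ^ 2)).const_mul 2).fun_mul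
        (hQ.hasDerivAt_fst hW h)).const_sub 1).fun_mul ((hφ'.pds hW).hasDerivAt_fst hW h))).unique
    ((((hφ'.hasDerivAt_fst hW h).const_mul 2).fun_mul ((hP.hasDerivAt_fst hW h).fun_add
      ((hQ.hasDerivAt_fst hW h).const_mul s))).congr_of_eventuallyEq (by
        filter_upwards [hcr.continuousAt.eventually_mem (hW.mem_nhds h)] with t ht
          using transport_phi ht)))
  -- the derivatives of `horizontal_phi` in `r` and in `s`
  have key2 := (((hφ'.pdr hW).hasDerivAt_fst hW h).fun_div dr hr).unique
    (((((hφ'.pds hW).hasDerivAt_fst hW h).fun_mul (hP.hasDerivAt_fst hW h)).fun_add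
      ((hφ'.hasDerivAt_fst hW h).fun_mul ((hP.pds hW).hasDerivAt_fst hW h))).fun_add
      ((((hφ'.hasDerivAt_fst hW h).const_mul s).fun_add
        (((dr.fun_pow 2).sub_const (s ^ 2)).fun_mul ((hφ'.pds hW).hasDerivAt_fst hW h))).fun_mul
        ((hQ.pds hW).hasDerivAt_fst hW h)) |>.congr_of_eventuallyEq (by
        filter_upwards [hcr.continuousAt.eventually_mem (hW.mem_nhds h)] with t ht
          using horizontal_phi hφ ht))
  have key3 := (((hφ'.pdr hW).hasDerivAt_snd hW h).div_const r).unique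
    (((((hφ'.pds hW).hasDerivAt_snd hW h).fun_mul (hP.hasDerivAt_snd hW h)).fun_add
      ((hφ'.hasDerivAt_snd hW h).fun_mul ((hP.pds hW).hasDerivAt_snd hW h))).fun_add
      (((ds.fun_mul (hφ'.hasDerivAt_snd hW h)).fun_add
        (((ds.fun_pow 2).const_sub (r ^ 2)).fun_mul ((hφ'.pds hW).hasDerivAt_snd hW h))).fun_mul
        ((hQ.pds hW).hasDerivAt_snd hW h)) |>.congr_of_eventuallyEq (by
        filter_upwards [hcs.continuousAt.eventually_mem (hW.mem_nhds h)] with t ht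
          using horizontal_phi hφ ht))
  have e1 := transport_phi h
  have e2 := transport_phi_s hφ h
  have e3 := horizontal_phi hφ h
  simp only [id] at key1 key2 key3
  push_cast at key1 key2 key3
  rw [pdr_pds_comm hφ isOpen_rectangle h.1] at e2 key1 key2
  rw [pdr_pds_comm hP hW h] at key2
  rw [pdr_pds_comm hQ hW h] at key2
  unfold scalarR3 scalarR1 scalarR2
  rw [pdr_pds_comm hP hW h]
  generalize pds (pdr (scalarP φ)) r s = Prs at *
  generalize pds (pds (scalarP φ)) r s = Pss at *
  generalize pds (pdr (scalarQ φ)) r s = Qrs at *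
  generalize pds (pds (scalarQ φ)) r s = Qss at *
  generalize pds (pdr φ) r s = φrs at *
  generalize pds (pds φ) r s = φss at *
  generalize pdr (pdr φ) r s = φrr at *
  generalize pdr (scalarP φ) r s = Pr at *
  generalize pds (scalarP φ) r s = Ps at *
  generalize pdr (scalarQ φ) r s = Qr at *
  generalize pds (scalarQ φ) r s = Qs at *
  generalize scalarP φ r s = P at *
  generalize scalarQ φ r s = Q at *
  generalize pdr φ r s = φr at *
  generalize pds φ r s = φs at *
  generalize φ r s = f at *
  -- `D (horizontal_phi) - (1/r) ∂_r (transport_phi)`, reduced by the three equations themselves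
  linear_combination (norm := skip) ((r ^ 2 - s ^ 2) * Qs - P) * e3
    + s / r * key2 + (1 - 2 * (r ^ 2 - s ^ 2) * Q) * key3 - key1 / r
    + (P + (r ^ 2 - s ^ 2) * Qs) * e2 + (Ps + s * Qs - 2 * Q) * e1
  field_simp
  ring

end ScalarFunctions

/-! ### Differentiation of spherically symmetric functions -/

section Symmetric

variable {n : ℕ} {φ h : ℝ → ℝ → ℝ} {ρ : ℝ} {x y a b : EuclideanSpace ℝ (Fin n)}

/-- The variable `s = ⟨x, y⟩ / |y|`. -/
def sCoord (x y : EuclideanSpace ℝ (Fin n)) : ℝ := inner ℝ x y / ‖y‖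

/-- The pairs `(x, y)` with `0 < |x| < ρ` and `y ≠ 0`, where `r`, `s` and `|y|` are smooth. -/
def slitDomain (n : ℕ) (ρ : ℝ) : Set (EuclideanSpace ℝ (Fin n) × EuclideanSpace ℝ (Fin n)) :=
  (Metric.ball 0 ρ ∩ {0}ᶜ) ×ˢ {0}ᶜ

theorem isOpen_slitDomain : IsOpen (slitDomain n ρ) :=
  (Metric.isOpen_ball.inter isOpen_compl_singleton).prod isOpen_compl_singleton

theorem slitDomain_subset : slitDomain n ρ ⊆ Metric.ball 0 ρ ×ˢ {0}ᶜ := fun _ h => ⟨h.1.1, h.2⟩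

theorem slitDomain_norm_fst_pos (h : (x, y) ∈ slitDomain n ρ) : 0 < ‖x‖ := norm_pos_iff.2 h.1.2

theorem slitDomain_norm_fst_lt (h : (x, y) ∈ slitDomain n ρ) : ‖x‖ < ρ := by
  simpa using h.1.1

theorem slitDomain_norm_snd_pos (h : (x, y) ∈ slitDomain n ρ) : 0 < ‖y‖ := norm_pos_iff.2 h.2

theorem inner_eq_norm_mul_sCoord (hy : 0 < ‖y‖) : inner ℝ x y = ‖y‖ * sCoord x y := by
  unfold sCoord
  field_simp

theorem abs_sCoord_le (x y : EuclideanSpace ℝ (Fin n)) : |sCoord x y| ≤ ‖x‖ := by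
  unfold sCoord
  rw [abs_div, abs_norm]
  exact div_le_of_le_mul₀ (norm_nonneg _) (norm_nonneg _) (abs_real_inner_le_norm x y)

theorem mem_rectangle (h : (x, y) ∈ slitDomain n ρ) : (‖x‖, sCoord x y) ∈ rectangle ρ := by
  have h1 := abs_le.1 (abs_sCoord_le x y)
  have h2 := slitDomain_norm_fst_lt h
  exact ⟨⟨slitDomain_norm_fst_pos h, h2⟩, ⟨by linarith [h1.1], by linarith [h1.2]⟩⟩

theorem hasDerivAt_norm_line (hx : x ≠ 0) (a : EuclideanSpace ℝ (Fin n)) :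
    HasDerivAt (fun t : ℝ => ‖x + t • a‖) (inner ℝ x a / ‖x‖) 0 := by
  have h1 := (hasDerivAt_add_smul x a).norm_sq
  have h2 : HasDerivAt (fun t : ℝ => √(‖x + t • a‖ ^ 2)) _ 0 :=
    h1.sqrt (by simpa using hx)
  simp only [Real.sqrt_sq (norm_nonneg _), zero_smul, add_zero] at h2
  exact h2.congr_deriv (by have := norm_pos_iff.2 hx; field_simp)

theorem hasDerivAt_sCoord_line (hy : y ≠ 0) (x a b : EuclideanSpace ℝ (Fin n)) :
    HasDerivAt (fun t : ℝ => sCoord (x + t • a) (y + t • b))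
      ((inner ℝ a y + inner ℝ x b) / ‖y‖ - sCoord x y * inner ℝ y b / ‖y‖ ^ 2) 0 := by
  have h1 := (hasDerivAt_add_smul x a).inner ℝ (hasDerivAt_add_smul y b)
  have hy' := norm_pos_iff.2 hy
  have h2 := h1.fun_div (hasDerivAt_norm_line hy b) (by simpa using hy)
  refine h2.congr_deriv ?_
  simp only [zero_smul, add_zero, sCoord]
  field_simp
  ring

theorem JointlySmoothOn.hasDerivAt_radial {W : Set (ℝ × ℝ)} (hh : JointlySmoothOn h W)
    (hW : IsOpen W) (hx : x ≠ 0) (hy : y ≠ 0) (hxy : (‖x‖, sCoord x y) ∈ W)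
    (a b : EuclideanSpace ℝ (Fin n)) :
    HasDerivAt (fun t : ℝ => h ‖x + t • a‖ (sCoord (x + t • a) (y + t • b)))
      (inner ℝ x a / ‖x‖ * Finsler.pdr h ‖x‖ (sCoord x y)
        + ((inner ℝ a y + inner ℝ x b) / ‖y‖ - sCoord x y * inner ℝ y b / ‖y‖ ^ 2)
          * Finsler.pds h ‖x‖ (sCoord x y)) 0 := by
  have := hh.hasDerivAt_comp_real hW (hasDerivAt_norm_line hx a)
    (hasDerivAt_sCoord_line hy x a b) (by simpa using hxy)
  simpa using this

/-! ### The fundamental tensor and the spray of a spherically symmetric metric -/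

theorem dirDeriv_sq (hφ : JointlySmoothOn φ (rectangle ρ))
    (hF : IsFinslerMetricOn (Metric.ball 0 ρ) (sphericallySymmetric n φ))
    (h : (x, y) ∈ slitDomain n ρ) (a b : EuclideanSpace ℝ (Fin n)) :
    dirDeriv (a, b) (fun u v => sphericallySymmetric n φ u v ^ 2) x y =
      2 * ‖y‖ ^ 2 * φ ‖x‖ (sCoord x y) * pdr φ ‖x‖ (sCoord x y) * (inner ℝ x a / ‖x‖)
        + 2 * ‖y‖ * φ ‖x‖ (sCoord x y) * pds φ ‖x‖ (sCoord x y) * (inner ℝ a y + inner ℝ x b)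
        + 2 * φ ‖x‖ (sCoord x y) * (φ ‖x‖ (sCoord x y) - sCoord x y * pds φ ‖x‖ (sCoord x y))
          * inner ℝ y b := by
  have hs := hF.sq_smooth.mono (slitDomain_subset (n := n) (ρ := ρ))
  refine dirDeriv_eq_of_hasDerivAt hs isOpen_slitDomain (fun _ _ _ => rfl) h ?_
  have h1 := hasDerivAt_norm_line (x := y) h.2 b
  have h2 := hφ.hasDerivAt_radial isOpen_rectangle h.1.2 h.2 (mem_rectangle h) a b
  refine ((h1.fun_mul h2).fun_pow 2).congr_deriv ?_
  have hy := slitDomain_norm_snd_pos h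
  simp only [zero_smul, add_zero]
  push_cast
  field_simp
  ring

theorem pdy_sq (hφ : JointlySmoothOn φ (rectangle ρ))
    (hF : IsFinslerMetricOn (Metric.ball 0 ρ) (sphericallySymmetric n φ))
    (h : (x, y) ∈ slitDomain n ρ) (l : Fin n) :
    pdy l (fun u v => sphericallySymmetric n φ u v ^ 2) x y =
      2 * (φ ‖x‖ (sCoord x y) * (φ ‖x‖ (sCoord x y) - sCoord x y * pds φ ‖x‖ (sCoord x y)) * y l
        + ‖y‖ * (φ ‖x‖ (sCoord x y) * pds φ ‖x‖ (sCoord x y)) * x l) := by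
  have hs := hF.sq_smooth.mono (slitDomain_subset (n := n) (ρ := ρ))
  rw [pdy_eq_dirDeriv hs isOpen_slitDomain h, dirDeriv_sq hφ hF h]
  simp [EuclideanSpace.inner_single_right]
  ring

theorem pdx_sq (hφ : JointlySmoothOn φ (rectangle ρ))
    (hF : IsFinslerMetricOn (Metric.ball 0 ρ) (sphericallySymmetric n φ))
    (h : (x, y) ∈ slitDomain n ρ) (l : Fin n) :
    pdx l (fun u v => sphericallySymmetric n φ u v ^ 2) x y =
      2 * (‖y‖ ^ 2 * φ ‖x‖ (sCoord x y) * pdr φ ‖x‖ (sCoord x y) / ‖x‖ * x l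
        + ‖y‖ * (φ ‖x‖ (sCoord x y) * pds φ ‖x‖ (sCoord x y)) * y l) := by
  have hs := hF.sq_smooth.mono (slitDomain_subset (n := n) (ρ := ρ))
  rw [pdx_eq_dirDeriv hs isOpen_slitDomain h, dirDeriv_sq hφ hF h]
  simp [EuclideanSpace.inner_single_right, EuclideanSpace.inner_single_left]
  ring

/-- The derivative of `∂(F²)/∂y^l` in a direction `(a, b)`. Here `r'`, `s'` stand for the
derivatives of `r` and `s` in this direction. -/
theorem dirDeriv_pdy_sq (hφ : JointlySmoothOn φ (rectangle ρ))
    (hF : IsFinslerMetricOn (Metric.ball 0 ρ) (sphericallySymmetric n φ))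
    (h : (x, y) ∈ slitDomain n ρ) (l : Fin n) (a b : EuclideanSpace ℝ (Fin n)) {r s r' s' : ℝ}
    (hr : r = ‖x‖) (hs : s = sCoord x y) (hr' : r' = inner ℝ x a / ‖x‖)
    (hs' : s' = (inner ℝ a y + inner ℝ x b) / ‖y‖ - sCoord x y * inner ℝ y b / ‖y‖ ^ 2) :
    dirDeriv (a, b) (pdy l (fun u v => sphericallySymmetric n φ u v ^ 2)) x y =
      2 * (((r' * pdr φ r s + s' * pds φ r s) * (φ r s - s * pds φ r s)
          + φ r s * (r' * pdr φ r s - s * (r' * pdr (pds φ) r s + s' * pds (pds φ) r s))) * y l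
        + φ r s * (φ r s - s * pds φ r s) * b l
        + (inner ℝ y b / ‖y‖ * (φ r s * pds φ r s)
          + ‖y‖ * ((r' * pdr φ r s + s' * pds φ r s) * pds φ r s
            + φ r s * (r' * pdr (pds φ) r s + s' * pds (pds φ) r s))) * x l
        + ‖y‖ * (φ r s * pds φ r s) * a l) := by
  subst hr hs hr' hs'
  have hsm := (hF.sq_smooth.mono (slitDomain_subset (n := n) (ρ := ρ))).pdy isOpen_slitDomain l
  refine dirDeriv_eq_of_hasDerivAt hsm isOpen_slitDomain (fun _ _ h => pdy_sq hφ hF h l) h ?_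
  have h1 := hasDerivAt_norm_line (x := y) h.2 b
  have h2 := hφ.hasDerivAt_radial isOpen_rectangle h.1.2 h.2 (mem_rectangle h) a b
  have h3 := (hφ.pds isOpen_rectangle).hasDerivAt_radial isOpen_rectangle h.1.2 h.2
    (mem_rectangle h) a b
  have h4 := hasDerivAt_sCoord_line h.2 x a b
  refine ((((h2.fun_mul (h2.fun_sub (h4.fun_mul h3))).fun_mul (hasDerivAt_line_apply y b l)).fun_add
    ((h1.fun_mul (h2.fun_mul h3)).fun_mul (hasDerivAt_line_apply x a l))).const_mul
      2).congr_deriv ?_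
  simp only [zero_smul, add_zero]
  ring

theorem inner_eq_sum (x y : EuclideanSpace ℝ (Fin n)) : inner ℝ x y = ∑ k, x k * y k := by
  rw [real_inner_comm]
  simp [PiLp.inner_apply]

/-- Contracting `g` with a vector differentiates half of `∂(F²)/∂y^l` along it. -/
theorem sum_fundamentalTensor_mul (hF : IsFinslerMetricOn (Metric.ball 0 ρ)
    (sphericallySymmetric n φ)) (h : (x, y) ∈ slitDomain n ρ) (l : Fin n)
    (v : EuclideanSpace ℝ (Fin n)) :
    ∑ i, fundamentalTensor (sphericallySymmetric n φ) x y l i * v i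
      = (1 / 2) * dirDeriv (0, v) (pdy l (fun u v => sphericallySymmetric n φ u v ^ 2)) x y := by
  have hsm := hF.sq_smooth.mono (slitDomain_subset (n := n) (ρ := ρ))
  have hO := isOpen_slitDomain (n := n) (ρ := ρ)
  rw [dirDeriv_eq_sum_partials (hsm.pdy hO l) hO h, mul_add]
  simp only [Finset.mul_sum, fundamentalTensor, Matrix.of_apply]
  simp only [PiLp.zero_apply, zero_mul, mul_zero, Finset.sum_const_zero, zero_add]
  refine Finset.sum_congr rfl fun i _ => ?_
  rw [pdy_comm hsm hO h]
  ring

/-- The fundamental tensor as a quadratic form. -/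
theorem sum_sum_fundamentalTensor (hφ : JointlySmoothOn φ (rectangle ρ))
    (hF : IsFinslerMetricOn (Metric.ball 0 ρ) (sphericallySymmetric n φ))
    (h : (x, y) ∈ slitDomain n ρ) (v : EuclideanSpace ℝ (Fin n)) {r s : ℝ}
    (hr : r = ‖x‖) (hs : s = sCoord x y) :
    ∑ l, v l * ∑ i, fundamentalTensor (sphericallySymmetric n φ) x y l i * v i
      = φ r s * (φ r s - s * pds φ r s) * ‖v‖ ^ 2
        + (inner ℝ x v / ‖y‖ - s * inner ℝ y v / ‖y‖ ^ 2) *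
          ((pds φ r s * (φ r s - s * pds φ r s) - s * φ r s * pds (pds φ) r s) * inner ℝ y v
            + ‖y‖ * (pds φ r s ^ 2 + φ r s * pds (pds φ) r s) * inner ℝ x v)
        + inner ℝ y v / ‖y‖ * (φ r s * pds φ r s) * inner ℝ x v := by
  simp only [sum_fundamentalTensor_mul hF h]
  simp only [dirDeriv_pdy_sq hφ hF h _ 0 v hr hs rfl rfl]
  have e1 : ‖v‖ ^ 2 = ∑ l, v l * v l := by rw [← inner_eq_sum, real_inner_self_eq_norm_sq]
  subst hr hs
  simp only [inner_zero_left, inner_zero_right, zero_div, zero_mul, zero_add, zero_sub,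
    PiLp.zero_apply, mul_zero, add_zero]
  rw [e1]
  generalize hI : inner ℝ x v / ‖y‖ - sCoord x y * inner ℝ y v / ‖y‖ ^ 2 = I
  generalize hJ : inner ℝ y v / ‖y‖ = J
  rw [inner_eq_sum x v, inner_eq_sum y v]
  simp only [Finset.mul_sum, ← Finset.sum_add_distrib]
  exact Finset.sum_congr rfl fun _ _ => by ring

theorem fundamentalTensor_quadratic_pos
    (hF : IsFinslerMetricOn (Metric.ball 0 ρ) (sphericallySymmetric n φ))
    (h : (x, y) ∈ slitDomain n ρ) {v : EuclideanSpace ℝ (Fin n)} (hv : v ≠ 0) :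
    0 < ∑ l, v l * ∑ i, fundamentalTensor (sphericallySymmetric n φ) x y l i * v i := by
  have := (hF.posDef x h.1.1 y h.2).dotProduct_mulVec_pos (x := v.ofLp) (by simpa using hv)
  simpa [dotProduct, Matrix.mulVec] using this

theorem exists_ne_zero_orthogonal (hn : 3 ≤ n) (x y : EuclideanSpace ℝ (Fin n)) :
    ∃ w : EuclideanSpace ℝ (Fin n), w ≠ 0 ∧ inner ℝ x w = 0 ∧ inner ℝ y w = 0 := by
  classical
  have h1 : Module.finrank ℝ (Submodule.span ℝ ({x, y} : Set (EuclideanSpace ℝ (Fin n)))) ≤ 2 := by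
    have := finrank_span_finset_le_card (R := ℝ) ({x, y} : Finset (EuclideanSpace ℝ (Fin n)))
    simp only [Finset.coe_insert, Finset.coe_singleton] at this
    exact this.trans Finset.card_le_two
  have h2 := Submodule.finrank_add_finrank_orthogonal
    (Submodule.span ℝ ({x, y} : Set (EuclideanSpace ℝ (Fin n))))
  rw [finrank_euclideanSpace_fin] at h2
  have h3 : (Submodule.span ℝ ({x, y} : Set (EuclideanSpace ℝ (Fin n))))ᗮ ≠ ⊥ := by
    intro h
    rw [h, finrank_bot] at h2
    omega
  obtain ⟨w, hw, hw0⟩ := Submodule.exists_mem_ne_zero_of_ne_bot h3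
  exact ⟨w, hw0, hw x (Submodule.subset_span (by simp)), hw y (Submodule.subset_span (by simp))⟩

end Symmetric

section SymmetricSpray

variable {n : ℕ} {φ : ℝ → ℝ → ℝ} {ρ : ℝ} {x y : EuclideanSpace ℝ (Fin n)}

/-- The denominator of `Q` is positive: test `g` on a vector orthogonal to `x` and `y`, which gives
`φ - s φ_s > 0` and covers `|s| = r`, and on the vector of the plane of `x` and `y` that is
`g`-orthogonal to `y`. -/
theorem mem_regularSet (hn : 3 ≤ n) (hφ : JointlySmoothOn φ (rectangle ρ))
    (hpos : ∀ p ∈ rectangle ρ, 0 < φ p.1 p.2)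
    (hF : IsFinslerMetricOn (Metric.ball 0 ρ) (sphericallySymmetric n φ))
    (h : (x, y) ∈ slitDomain n ρ) : (‖x‖, sCoord x y) ∈ regularSet φ ρ := by
  have hφ0 : 0 < φ ‖x‖ (sCoord x y) := hpos _ (mem_rectangle h)
  refine ⟨mem_rectangle h, hφ0, ?_⟩
  have hu := slitDomain_norm_snd_pos h
  have key := fun v => sum_sum_fundamentalTensor hφ hF h v rfl rfl
  have hxy := inner_eq_norm_mul_sCoord (x := x) hu
  have hxx := real_inner_self_eq_norm_sq x
  have hyy := real_inner_self_eq_norm_sq y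
  have hs := abs_sCoord_le x y
  change 0 < scalarDen φ ‖x‖ (sCoord x y)
  unfold scalarDen
  generalize hsdef : sCoord x y = s at *
  generalize hrdef : ‖x‖ = r at *
  generalize hudef : ‖y‖ = u at *
  generalize φ r s = f at *
  generalize pds (pds φ) r s = fss at *
  generalize pds φ r s = fs at *
  have hA : 0 < f - s * fs := by
    obtain ⟨w, hw, hxw, hyw⟩ := exists_ne_zero_orthogonal hn x y
    have h1 := fundamentalTensor_quadratic_pos hF h hw
    rw [key w, hxw, hyw] at h1
    simp only [mul_zero, zero_div, sub_zero, add_zero, zero_mul] at h1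
    exact pos_of_mul_pos_right (pos_of_mul_pos_left h1 (by positivity)) hφ0.le
  have hm : 0 ≤ r ^ 2 - s ^ 2 := by
    have := sq_le_sq.2 (hs.trans (le_abs_self r))
    linarith
  rcases hm.eq_or_lt with hm0 | hm0
  · rw [← hm0]
    linarith
  -- `v = x - c y` is the projection of `x` along `y` to the kernel of `∂F/∂y`
  obtain ⟨c, hc⟩ : ∃ c, c = s / u + (r ^ 2 - s ^ 2) * fs / (u * f) := ⟨_, rfl⟩
  have hxv : inner ℝ x (x - c • y) = (r ^ 2 - s ^ 2) * (f - s * fs) / f := by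
    rw [inner_sub_right, inner_smul_right, hxx, hxy, hc]
    field_simp
    ring
  have hyv : inner ℝ y (x - c • y) = - (u * (r ^ 2 - s ^ 2) * fs / f) := by
    rw [inner_sub_right, inner_smul_right, hyy, real_inner_comm, hxy, hc]
    field_simp
    ring
  have hvv : ‖x - c • y‖ ^ 2 = (r ^ 2 - s ^ 2) + (r ^ 2 - s ^ 2) ^ 2 * fs ^ 2 / f ^ 2 := by
    rw [← real_inner_self_eq_norm_sq, inner_sub_left, inner_smul_left, hxv, hyv, hc]
    simp only [conj_trivial]
    field_simp
    ring
  have hv0 : x - c • y ≠ 0 := by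
    intro h0
    rw [h0] at hvv
    simp only [norm_zero] at hvv
    have : 0 ≤ (r ^ 2 - s ^ 2) ^ 2 * fs ^ 2 / f ^ 2 := by positivity
    linarith
  have h1 := fundamentalTensor_quadratic_pos hF h hv0
  rw [key, hxv, hyv, hvv] at h1
  have h2 : 0 < (r ^ 2 - s ^ 2) * f * (f - s * fs + (r ^ 2 - s ^ 2) * fss) := by
    convert h1 using 1
    field_simp
    ring
  exact pos_of_mul_pos_right h2 (by positivity)

/-- The vector `G = |y| P y + |y|² Q x` of spray coefficients. The spray is the derivation in the
direction `(y, -2 G)`. -/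
def sprayVector (φ : ℝ → ℝ → ℝ) (x y : EuclideanSpace ℝ (Fin n)) : EuclideanSpace ℝ (Fin n) :=
  (‖y‖ * scalarP φ ‖x‖ (sCoord x y)) • y + (‖y‖ ^ 2 * scalarQ φ ‖x‖ (sCoord x y)) • x

theorem inner_fst_sprayVector (hy : 0 < ‖y‖) :
    inner ℝ x (sprayVector φ x y) = ‖y‖ ^ 2 * (sCoord x y * scalarP φ ‖x‖ (sCoord x y)
      + ‖x‖ ^ 2 * scalarQ φ ‖x‖ (sCoord x y)) := by
  rw [sprayVector, inner_add_right, inner_smul_right, inner_smul_right,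
    real_inner_self_eq_norm_sq, inner_eq_norm_mul_sCoord hy]
  ring

theorem inner_snd_sprayVector (hy : 0 < ‖y‖) :
    inner ℝ y (sprayVector φ x y) = ‖y‖ ^ 3 * (scalarP φ ‖x‖ (sCoord x y)
      + sCoord x y * scalarQ φ ‖x‖ (sCoord x y)) := by
  rw [sprayVector, inner_add_right, inner_smul_right, inner_smul_right,
    real_inner_self_eq_norm_sq, real_inner_comm, inner_eq_norm_mul_sCoord hy]
  ring

/-- The derivative of `s` along the spray is `|y| (1 - 2 (r² - s²) Q)`. -/
theorem spray_sCoord (hy : 0 < ‖y‖) :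
    ‖y‖ * (1 - 2 * (‖x‖ ^ 2 - sCoord x y ^ 2) * scalarQ φ ‖x‖ (sCoord x y))
      = (inner ℝ y y + inner ℝ x (-(2 : ℝ) • sprayVector φ x y)) / ‖y‖
        - sCoord x y * inner ℝ y (-(2 : ℝ) • sprayVector φ x y) / ‖y‖ ^ 2 := by
  rw [inner_smul_right, inner_smul_right, inner_fst_sprayVector hy, inner_snd_sprayVector hy,
    real_inner_self_eq_norm_sq]
  field_simp
  ring

theorem spray_norm_snd (hy : 0 < ‖y‖) :
    inner ℝ y (-(2 : ℝ) • sprayVector φ x y) / ‖y‖ = -2 * ‖y‖ ^ 2 * (scalarP φ ‖x‖ (sCoord x y)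
      + sCoord x y * scalarQ φ ‖x‖ (sCoord x y)) := by
  rw [inner_smul_right, inner_snd_sprayVector hy]
  field_simp

theorem spray_norm_fst (hy : 0 < ‖y‖) : ‖y‖ * (sCoord x y / ‖x‖) = inner ℝ x y / ‖x‖ := by
  rw [inner_eq_norm_mul_sCoord hy]
  ring

/-- The spray of a spherically symmetric metric is `G = |y| P y + |y|² Q x`: this vector solves the
Euler-Lagrange equations `S(∂(F²)/∂y^l) = ∂(F²)/∂x^l`, by the transport equations for `φ` and
`φ_s`, and they determine it because `g` is nondegenerate. -/
theorem sprayCoeff_sphericallySymmetric (hn : 3 ≤ n) (hφ : JointlySmoothOn φ (rectangle ρ))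
    (hpos : ∀ p ∈ rectangle ρ, 0 < φ p.1 p.2)
    (hF : IsFinslerMetricOn (Metric.ball 0 ρ) (sphericallySymmetric n φ))
    (h : (x, y) ∈ slitDomain n ρ) (i : Fin n) :
    sprayCoeff (sphericallySymmetric n φ) i x y = sprayVector φ x y i := by
  have hreg := mem_regularSet hn hφ hpos hF h
  have hu := slitDomain_norm_snd_pos h
  have hO := isOpen_slitDomain (n := n) (ρ := ρ)
  have hsm := hF.sq_smooth.mono (slitDomain_subset (n := n) (ρ := ρ))
  refine hF.sprayCoeff_eq h.1.1 h.2 _ (fun l => ?_) i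
  have h1 : ∑ i, fundamentalTensor (sphericallySymmetric n φ) x y l i * (4 * sprayVector φ x y i)
      = - dirDeriv (0, -(2 : ℝ) • sprayVector φ x y)
        (pdy l (fun u v => sphericallySymmetric n φ u v ^ 2)) x y := by
    have e := sum_fundamentalTensor_mul hF h l (-(2 : ℝ) • sprayVector φ x y)
    rw [← mul_left_cancel_iff_of_pos (show (0 : ℝ) < 1 / 2 by norm_num), mul_neg, ← e,
      Finset.mul_sum, ← Finset.sum_neg_distrib]
    exact Finset.sum_congr rfl fun i _ => by simp only [PiLp.smul_apply, smul_eq_mul]; ring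
  have h2 : ∑ k, pdx k (pdy l (fun u v => sphericallySymmetric n φ u v ^ 2)) x y * y k
      = dirDeriv (y, 0) (pdy l (fun u v => sphericallySymmetric n φ u v ^ 2)) x y := by
    rw [dirDeriv_eq_sum_partials (hsm.pdy hO l) hO h]
    simp [mul_comm]
  have h3 : dirDeriv (y, -(2 : ℝ) • sprayVector φ x y)
        (pdy l (fun u v => sphericallySymmetric n φ u v ^ 2)) x y
      = dirDeriv (y, 0) (pdy l (fun u v => sphericallySymmetric n φ u v ^ 2)) x y
        + dirDeriv (0, -(2 : ℝ) • sprayVector φ x y)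
        (pdy l (fun u v => sphericallySymmetric n φ u v ^ 2)) x y := by
    simp only [dirDeriv, ← map_add, Prod.mk_add_mk, add_zero, zero_add]
  have EL : dirDeriv (y, -(2 : ℝ) • sprayVector φ x y)
        (pdy l (fun u v => sphericallySymmetric n φ u v ^ 2)) x y
      = pdx l (fun u v => sphericallySymmetric n φ u v ^ 2) x y := by
    rw [dirDeriv_pdy_sq hφ hF h l _ _ rfl rfl (spray_norm_fst hu) (spray_sCoord hu),
      spray_norm_snd hu, pdx_sq hφ hF h]
    have e1 := transport_phi hreg
    have e2 := transport_phi_s hφ hreg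
    simp only [sprayVector, PiLp.smul_apply, PiLp.add_apply, smul_eq_mul]
    linear_combination
      (2 * ‖y‖ * (φ ‖x‖ (sCoord x y) - sCoord x y * pds φ ‖x‖ (sCoord x y)) * y l
        + 2 * ‖y‖ ^ 2 * pds φ ‖x‖ (sCoord x y) * x l) * e1
      + (2 * ‖y‖ ^ 2 * φ ‖x‖ (sCoord x y) * x l
        - 2 * ‖y‖ * sCoord x y * φ ‖x‖ (sCoord x y) * y l) * e2
  rw [h1, h2, ← EL, h3]
  ring

end SymmetricSpray

/-! ### The Riemann curvature of a spherically symmetric metric -/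

section SymmetricCurvature

variable {n : ℕ} {φ : ℝ → ℝ → ℝ} {ρ : ℝ} {x y : EuclideanSpace ℝ (Fin n)}

theorem dirDeriv_sprayCoeff (hn : 3 ≤ n) (hφ : JointlySmoothOn φ (rectangle ρ))
    (hpos : ∀ p ∈ rectangle ρ, 0 < φ p.1 p.2)
    (hF : IsFinslerMetricOn (Metric.ball 0 ρ) (sphericallySymmetric n φ))
    (h : (x, y) ∈ slitDomain n ρ) (i : Fin n) (a b : EuclideanSpace ℝ (Fin n)) {r s u r' s' u' : ℝ}
    (hr : r = ‖x‖) (hs : s = sCoord x y) (hu : u = ‖y‖) (hr' : r' = inner ℝ x a / ‖x‖)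
    (hs' : s' = (inner ℝ a y + inner ℝ x b) / ‖y‖ - sCoord x y * inner ℝ y b / ‖y‖ ^ 2)
    (hu' : u' = inner ℝ y b / ‖y‖) :
    dirDeriv (a, b) (sprayCoeff (sphericallySymmetric n φ) i) x y =
      (u' * scalarP φ r s + u * (r' * pdr (scalarP φ) r s + s' * pds (scalarP φ) r s)) * y i
        + u * scalarP φ r s * b i
        + (2 * u * u' * scalarQ φ r s
          + u ^ 2 * (r' * pdr (scalarQ φ) r s + s' * pds (scalarQ φ) r s)) * x i
        + u ^ 2 * scalarQ φ r s * a i := by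
  subst hr hs hu hr' hs' hu'
  have hsm := (hF.sprayCoeff_smooth Metric.isOpen_ball i).mono
    (slitDomain_subset (n := n) (ρ := ρ))
  refine dirDeriv_eq_of_hasDerivAt hsm isOpen_slitDomain
    (fun _ _ h => sprayCoeff_sphericallySymmetric hn hφ hpos hF h i) h ?_
  have hreg := mem_regularSet hn hφ hpos hF h
  have hW := isOpen_regularSet hφ
  have h1 := hasDerivAt_norm_line (x := y) h.2 b
  have hP := (scalarP_smooth hφ).hasDerivAt_radial hW h.1.2 h.2 hreg a b
  have hQ := (scalarQ_smooth hφ).hasDerivAt_radial hW h.1.2 h.2 hreg a b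
  refine (((h1.fun_mul hP).fun_mul (hasDerivAt_line_apply y b i)).fun_add
    (((h1.fun_pow 2).fun_mul hQ).fun_mul (hasDerivAt_line_apply x a i))).congr_deriv ?_
  simp only [zero_smul, add_zero]
  push_cast
  ring

theorem sprayCoeff_euler (hn : 3 ≤ n) (hφ : JointlySmoothOn φ (rectangle ρ))
    (hpos : ∀ p ∈ rectangle ρ, 0 < φ p.1 p.2)
    (hF : IsFinslerMetricOn (Metric.ball 0 ρ) (sphericallySymmetric n φ))
    (h : (x, y) ∈ slitDomain n ρ) (i : Fin n) :
    ∑ k, y k * pdy k (sprayCoeff (sphericallySymmetric n φ) i) x y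
      = 2 * sprayCoeff (sphericallySymmetric n φ) i x y := by
  have hsm := (hF.sprayCoeff_smooth Metric.isOpen_ball i).mono
    (slitDomain_subset (n := n) (ρ := ρ))
  have h1 := dirDeriv_eq_sum_partials hsm isOpen_slitDomain h 0 y
  simp only [PiLp.zero_apply, zero_mul, Finset.sum_const_zero, zero_add] at h1
  have hu := slitDomain_norm_snd_pos h
  have hu' : ‖y‖ = inner ℝ y y / ‖y‖ := by
    rw [real_inner_self_eq_norm_sq]
    field_simp
  have hs' : 0 = (inner ℝ (0 : EuclideanSpace ℝ (Fin n)) y + inner ℝ x y) / ‖y‖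
      - sCoord x y * inner ℝ y y / ‖y‖ ^ 2 := by
    rw [inner_zero_left, real_inner_self_eq_norm_sq, inner_eq_norm_mul_sCoord hu]
    field_simp
    ring
  have hr' : 0 = inner ℝ x (0 : EuclideanSpace ℝ (Fin n)) / ‖x‖ := by simp
  rw [← h1, dirDeriv_sprayCoeff hn hφ hpos hF h i 0 y rfl rfl rfl hr' hs' hu',
    sprayCoeff_sphericallySymmetric hn hφ hpos hF h]
  simp only [sprayVector, PiLp.smul_apply, PiLp.add_apply, PiLp.zero_apply, smul_eq_mul]
  ring

theorem pdx_sprayCoeff (hn : 3 ≤ n) (hφ : JointlySmoothOn φ (rectangle ρ))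
    (hpos : ∀ p ∈ rectangle ρ, 0 < φ p.1 p.2)
    (hF : IsFinslerMetricOn (Metric.ball 0 ρ) (sphericallySymmetric n φ))
    (h : (x, y) ∈ slitDomain n ρ) (i k : Fin n) {r s u : ℝ}
    (hr : r = ‖x‖) (hs : s = sCoord x y) (hu : u = ‖y‖) :
    pdx k (sprayCoeff (sphericallySymmetric n φ) i) x y =
      u * (x k / r * pdr (scalarP φ) r s + y k / u * pds (scalarP φ) r s) * y i
        + u ^ 2 * (x k / r * pdr (scalarQ φ) r s + y k / u * pds (scalarQ φ) r s) * x i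
        + u ^ 2 * scalarQ φ r s * (if i = k then 1 else 0) := by
  have hsm := (hF.sprayCoeff_smooth Metric.isOpen_ball i).mono
    (slitDomain_subset (n := n) (ρ := ρ))
  rw [pdx_eq_dirDeriv hsm isOpen_slitDomain h,
    dirDeriv_sprayCoeff hn hφ hpos hF h i _ _ hr hs hu (r' := x k / r) (s' := y k / u) (u' := 0)
      (by simp [EuclideanSpace.inner_single_right, hr])
      (by simp [EuclideanSpace.inner_single_left, hu]) (by simp)]
  simp

/-- The nonlinear connection `N^i_k` of a spherically symmetric metric. -/
theorem nonlinearConnection_sphericallySymmetric (hn : 3 ≤ n)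
    (hφ : JointlySmoothOn φ (rectangle ρ))
    (hpos : ∀ p ∈ rectangle ρ, 0 < φ p.1 p.2)
    (hF : IsFinslerMetricOn (Metric.ball 0 ρ) (sphericallySymmetric n φ))
    (h : (x, y) ∈ slitDomain n ρ) (i k : Fin n) {r s u : ℝ}
    (hr : r = ‖x‖) (hs : s = sCoord x y) (hu : u = ‖y‖) :
    nonlinearConnection (sphericallySymmetric n φ) i k x y =
      u * scalarP φ r s * (if i = k then 1 else 0)
        + y i * ((scalarP φ r s - s * pds (scalarP φ) r s) / u * y k + pds (scalarP φ) r s * x k)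
        + x i * ((2 * scalarQ φ r s - s * pds (scalarQ φ) r s) * y k
          + u * pds (scalarQ φ) r s * x k) := by
  have hsm := (hF.sprayCoeff_smooth Metric.isOpen_ball i).mono
    (slitDomain_subset (n := n) (ρ := ρ))
  have hu0 : 0 < u := hu ▸ slitDomain_norm_snd_pos h
  rw [nonlinearConnection, pdy_eq_dirDeriv hsm isOpen_slitDomain h,
    dirDeriv_sprayCoeff hn hφ hpos hF h i _ _ hr hs hu (r' := 0)
      (s' := x k / u - s * y k / u ^ 2) (u' := y k / u) (by simp)
      (by simp [EuclideanSpace.inner_single_right, hu, hs])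
      (by simp [EuclideanSpace.inner_single_right, hu])]
  simp only [PiLp.zero_apply, PiLp.single_apply]
  field_simp
  ring

/-- The product of two matrices of the form `c δ + y ⊗ Y + x ⊗ X`. -/
theorem sum_mul_scalar_add_rank_two (c : ℝ) (x y X Y : Fin n → ℝ) (i k : Fin n) :
    ∑ m, (c * (if i = m then 1 else 0) + y i * Y m + x i * X m)
        * (c * (if m = k then 1 else 0) + y m * Y k + x m * X k)
      = c ^ 2 * (if i = k then 1 else 0) + 2 * c * (y i * Y k + x i * X k)
        + y i * ((∑ m, Y m * y m) * Y k + (∑ m, Y m * x m) * X k)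
        + x i * ((∑ m, X m * y m) * Y k + (∑ m, X m * x m) * X k) := by
  have e : ∀ m, (c * (if i = m then 1 else 0) + y i * Y m + x i * X m)
        * (c * (if m = k then 1 else 0) + y m * Y k + x m * X k)
      = (if i = m then c * (c * (if m = k then 1 else 0) + y m * Y k + x m * X k) else 0)
        + (if m = k then c * (y i * Y m + x i * X m) else 0)
        + (y i * Y k * (Y m * y m) + y i * X k * (Y m * x m)
        + (x i * Y k * (X m * y m) + x i * X k * (X m * x m))) := by
    intro m
    split_ifs <;> ring
  simp only [e, Finset.sum_add_distrib, Finset.sum_ite_eq, Finset.sum_ite_eq', Finset.mem_univ,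
    if_true, ← Finset.mul_sum]
  ring

theorem sum_linear_mul (p q : ℝ) (x y z : EuclideanSpace ℝ (Fin n)) :
    ∑ m, (p * y m + q * x m) * z m = p * inner ℝ y z + q * inner ℝ x z := by
  simp only [inner_eq_sum, Finset.mul_sum, ← Finset.sum_add_distrib]
  exact Finset.sum_congr rfl fun _ _ => by ring

/-- The derivative of `N^i_k` along the spray. Here `u'`, `s'` stand for the derivatives of
`u = |y|` and `s` along the spray; that of `r` is `u s / r`. -/
theorem dirDeriv_spray_nonlinearConnection (hn : 3 ≤ n)
    (hφ : JointlySmoothOn φ (rectangle ρ))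
    (hpos : ∀ p ∈ rectangle ρ, 0 < φ p.1 p.2)
    (hF : IsFinslerMetricOn (Metric.ball 0 ρ) (sphericallySymmetric n φ))
    (h : (x, y) ∈ slitDomain n ρ) (i k : Fin n) {r s u u' s' : ℝ}
    (hr : r = ‖x‖) (hs : s = sCoord x y) (hu : u = ‖y‖)
    (hu' : u' = -2 * u ^ 2 * (scalarP φ r s + s * scalarQ φ r s))
    (hs' : s' = u * (1 - 2 * (r ^ 2 - s ^ 2) * scalarQ φ r s)) :
    dirDeriv (y, -(2 : ℝ) • sprayVector φ x y)
        (nonlinearConnection (sphericallySymmetric n φ) i k) x y =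
      (u' * scalarP φ r s + u * (u * (s / r) * pdr (scalarP φ) r s + s' * pds (scalarP φ) r s))
          * (if i = k then 1 else 0)
        - 2 * (u * scalarP φ r s * y i + u ^ 2 * scalarQ φ r s * x i)
          * ((scalarP φ r s - s * pds (scalarP φ) r s) / u * y k + pds (scalarP φ) r s * x k)
        + y i * (((u * (s / r) * pdr (scalarP φ) r s
              - s * (u * (s / r) * pdr (pds (scalarP φ)) r s + s' * pds (pds (scalarP φ)) r s)) / u
              - (scalarP φ r s - s * pds (scalarP φ) r s) * u' / u ^ 2) * y k
          - (scalarP φ r s - s * pds (scalarP φ) r s) / u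
            * (2 * (u * scalarP φ r s * y k + u ^ 2 * scalarQ φ r s * x k))
          + (u * (s / r) * pdr (pds (scalarP φ)) r s + s' * pds (pds (scalarP φ)) r s) * x k
          + pds (scalarP φ) r s * y k)
        + y i * ((2 * scalarQ φ r s - s * pds (scalarQ φ) r s) * y k
          + u * pds (scalarQ φ) r s * x k)
        + x i * ((2 * (u * (s / r) * pdr (scalarQ φ) r s + s' * pds (scalarQ φ) r s)
              - s' * pds (scalarQ φ) r s
              - s * (u * (s / r) * pdr (pds (scalarQ φ)) r s + s' * pds (pds (scalarQ φ)) r s))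
              * y k
          - (2 * scalarQ φ r s - s * pds (scalarQ φ) r s)
            * (2 * (u * scalarP φ r s * y k + u ^ 2 * scalarQ φ r s * x k))
          + (u' * pds (scalarQ φ) r s
              + u * (u * (s / r) * pdr (pds (scalarQ φ)) r s + s' * pds (pds (scalarQ φ)) r s))
            * x k
          + u * pds (scalarQ φ) r s * y k) := by
  have hW := isOpen_regularSet hφ
  have hreg := mem_regularSet hn hφ hpos hF h
  have hu0 := slitDomain_norm_snd_pos h
  have hsm : JointlySmoothOn (nonlinearConnection (sphericallySymmetric n φ) i k)
      (slitDomain n ρ) := ((hF.sprayCoeff_smooth Metric.isOpen_ball i).mono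
    (slitDomain_subset (n := n) (ρ := ρ))).pdy isOpen_slitDomain k
  refine dirDeriv_eq_of_hasDerivAt hsm isOpen_slitDomain
    (fun _ _ h => nonlinearConnection_sphericallySymmetric hn hφ hpos hF h i k rfl rfl rfl) h ?_
  have hrad := fun {f : ℝ → ℝ → ℝ} (hf : JointlySmoothOn f (regularSet φ ρ)) =>
    hf.hasDerivAt_radial hW h.1.2 h.2 hreg y (-(2 : ℝ) • sprayVector φ x y)
  have hP := scalarP_smooth hφ
  have hQ := scalarQ_smooth hφ
  have dP := hrad hP
  have dPs := hrad (hP.pds hW)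
  have dQ := hrad hQ
  have dQs := hrad (hQ.pds hW)
  have du := hasDerivAt_norm_line (x := y) h.2 (-(2 : ℝ) • sprayVector φ x y)
  have ds := hasDerivAt_sCoord_line h.2 x y (-(2 : ℝ) • sprayVector φ x y)
  rw [← spray_norm_fst hu0, ← spray_sCoord hu0] at dP dPs dQ dQs
  rw [← spray_sCoord hu0] at ds
  rw [spray_norm_snd hu0] at du
  have dx := fun j => hasDerivAt_line_apply x y j
  have dy := fun j => hasDerivAt_line_apply y (-(2 : ℝ) • sprayVector φ x y) j
  subst hr hs hu
  rw [← hs'] at dP dPs dQ dQs ds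
  rw [← hu'] at du
  refine ((((du.fun_mul dP).mul_const (if i = k then 1 else 0)).fun_add ((dy i).fun_mul
    ((((dP.fun_sub (ds.fun_mul dPs)).fun_div du (by simpa using h.2)).fun_mul (dy k)).fun_add
      (dPs.fun_mul (dx k))))).fun_add ((dx i).fun_mul
    ((((dQ.const_mul 2).fun_sub (ds.fun_mul dQs)).fun_mul (dy k)).fun_add
      ((du.fun_mul dQs).fun_mul (dx k))))).congr_deriv ?_
  simp only [zero_smul, add_zero, sprayVector, PiLp.smul_apply, PiLp.add_apply, smul_eq_mul]
  generalize (if i = k then (1 : ℝ) else 0) = δ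
  field_simp
  ring

/-- The Riemann curvature of a spherically symmetric metric. The coefficients of `δ^i_k`, `y^i x_k`
and `x^i x_k` are `R₁`, `R₃` and `R₂` up to powers of `|y|`, and the others follow from
`R^i_k y^k = 0`. -/
theorem riemannCurvature_sphericallySymmetric (hn : 3 ≤ n)
    (hφ : JointlySmoothOn φ (rectangle ρ))
    (hpos : ∀ p ∈ rectangle ρ, 0 < φ p.1 p.2)
    (hF : IsFinslerMetricOn (Metric.ball 0 ρ) (sphericallySymmetric n φ))
    (h : (x, y) ∈ slitDomain n ρ) (i k : Fin n) {r s u : ℝ}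
    (hr : r = ‖x‖) (hs : s = sCoord x y) (hu : u = ‖y‖) :
    riemannCurvature (sphericallySymmetric n φ) i k x y =
      u ^ 2 * scalarR1 φ r s * (if i = k then 1 else 0)
        + y i * (u * scalarR3 φ r s * x k - (scalarR1 φ r s + s * scalarR3 φ r s) * y k)
        + x i * (scalarR2 φ r s * (u ^ 2 * x k - u * s * y k)) := by
  have hreg := mem_regularSet hn hφ hpos hF h
  have hW := isOpen_regularSet hφ
  have hsm := fun i => (hF.sprayCoeff_smooth Metric.isOpen_ball i).mono
    (slitDomain_subset (n := n) (ρ := ρ))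
  have hu0 : 0 < u := hu ▸ slitDomain_norm_snd_pos h
  have hr0 : 0 < r := hr ▸ slitDomain_norm_fst_pos h
  rw [riemannCurvature_eq_spray isOpen_slitDomain hsm
    (fun i x y h => sprayCoeff_euler hn hφ hpos hF h i) h i k]
  have hdir : (WithLp.toLp 2 fun l => -2 * sprayCoeff (sphericallySymmetric n φ) l x y)
      = -(2 : ℝ) • sprayVector φ x y := by
    ext l
    simp [sprayCoeff_sphericallySymmetric hn hφ hpos hF h]
  rw [hdir, pdx_sprayCoeff hn hφ hpos hF h i k hr hs hu,
    dirDeriv_spray_nonlinearConnection hn hφ hpos hF h i k hr hs hu rfl rfl]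
  simp only [nonlinearConnection_sphericallySymmetric hn hφ hpos hF h _ _ hr hs hu]
  rw [sum_mul_scalar_add_rank_two (u * scalarP φ r s) x y
    (fun m => (2 * scalarQ φ r s - s * pds (scalarQ φ) r s) * y m + u * pds (scalarQ φ) r s * x m)
    (fun m => (scalarP φ r s - s * pds (scalarP φ) r s) / u * y m + pds (scalarP φ) r s * x m)]
  simp only [sum_linear_mul]
  have hxy : inner ℝ x y = u * s := by
    rw [hu, hs]
    exact inner_eq_norm_mul_sCoord (slitDomain_norm_snd_pos h)
  rw [real_inner_comm x y, hxy, real_inner_self_eq_norm_sq, real_inner_self_eq_norm_sq, ← hr, ← hu]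
  rw [← hr, ← hs] at hreg
  unfold scalarR1 scalarR2 scalarR3
  rw [pdr_pds_comm (scalarP_smooth hφ) hW hreg, pdr_pds_comm (scalarQ_smooth hφ) hW hreg]
  generalize (if i = k then (1 : ℝ) else 0) = δ
  generalize pds (pdr (scalarP φ)) r s = Prs
  generalize pds (pds (scalarP φ)) r s = Pss
  generalize pds (pdr (scalarQ φ)) r s = Qrs
  generalize pds (pds (scalarQ φ)) r s = Qss
  generalize pdr (scalarP φ) r s = Pr
  generalize pds (scalarP φ) r s = Ps
  generalize pdr (scalarQ φ) r s = Qr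
  generalize pds (scalarQ φ) r s = Qs
  generalize scalarP φ r s = P
  generalize scalarQ φ r s = Q
  field_simp
  ring

end SymmetricCurvature

/-! ### Constant flag curvature -/

section ConstantCurvature

variable {n : ℕ} {φ : ℝ → ℝ → ℝ} {ρ : ℝ} {x y : EuclideanSpace ℝ (Fin n)}

theorem scalarR2_continuousOn (hφ : JointlySmoothOn φ (rectangle ρ)) :
    ContinuousOn (fun p : ℝ × ℝ => scalarR2 φ p.1 p.2) (regularSet φ ρ) := by
  have hW := isOpen_regularSet hφ
  have hQ := scalarQ_smooth hφ
  have cQ := hQ.continuousOn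
  have cQr := (hQ.pdr hW).continuousOn
  have cQs := (hQ.pds hW).continuousOn
  have cQrs := ((hQ.pdr hW).pds hW).continuousOn
  have cQss := ((hQ.pds hW).pds hW).continuousOn
  have h1 : ContinuousOn (fun p : ℝ × ℝ => p.1) (regularSet φ ρ) := continuousOn_fst
  have h2 : ContinuousOn (fun p : ℝ × ℝ => p.2) (regularSet φ ρ) := continuousOn_snd
  exact (((continuousOn_const.div h1 fun p hp => hp.1.1.1.ne').mul
    (((continuousOn_const.mul cQr).sub (h2.mul cQrs)).sub (h1.mul cQss))).add
    ((continuousOn_const.mul cQ).mul ((continuousOn_const.mul cQ).sub (h2.mul cQs)))).add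
    (((h1.pow 2).sub (h2.pow 2)).mul (((continuousOn_const.mul cQ).mul cQss).sub (cQs.pow 2)))

/-- The covector `g_{kl} y^l`, half of `∂(F²)/∂y^k`. -/
theorem sum_fundamentalTensor_mul_snd (hφ : JointlySmoothOn φ (rectangle ρ))
    (hF : IsFinslerMetricOn (Metric.ball 0 ρ) (sphericallySymmetric n φ))
    (h : (x, y) ∈ slitDomain n ρ) (k : Fin n) {r s u : ℝ}
    (hr : r = ‖x‖) (hs : s = sCoord x y) (hu : u = ‖y‖) :
    ∑ l, fundamentalTensor (sphericallySymmetric n φ) x y k l * y l =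
      φ r s * (φ r s - s * pds φ r s) * y k + u * (φ r s * pds φ r s) * x k := by
  have hu0 := slitDomain_norm_snd_pos h
  have hs' : 0 = (inner ℝ (0 : EuclideanSpace ℝ (Fin n)) y + inner ℝ x y) / ‖y‖
      - sCoord x y * inner ℝ y y / ‖y‖ ^ 2 := by
    rw [inner_zero_left, real_inner_self_eq_norm_sq, inner_eq_norm_mul_sCoord hu0]
    field_simp
    ring
  have hr' : 0 = inner ℝ x (0 : EuclideanSpace ℝ (Fin n)) / ‖x‖ := by simp
  rw [sum_fundamentalTensor_mul hF h, dirDeriv_pdy_sq hφ hF h k 0 y hr hs hr' hs',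
    real_inner_self_eq_norm_sq, ← hu]
  rw [← hu] at hu0
  simp only [PiLp.zero_apply]
  field_simp
  ring

theorem sphericallySymmetric_eq (φ : ℝ → ℝ → ℝ) (x y : EuclideanSpace ℝ (Fin n)) :
    sphericallySymmetric n φ x y = ‖y‖ * φ ‖x‖ (sCoord x y) := rfl

/-- If `R₁ = K φ²` and `R₂ = 0`, the identity `scalarR3_eq` gives `R₃ = -K φ φ_s`, which is the
value that constant flag curvature requires. -/
theorem hasConstantFlagCurvatureOn_of_scalar (hn : 3 ≤ n) (hφ : JointlySmoothOn φ (rectangle ρ))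
    (hpos : ∀ p ∈ rectangle ρ, 0 < φ p.1 p.2)
    (hF : IsFinslerMetricOn (Metric.ball 0 ρ) (sphericallySymmetric n φ)) {K : ℝ}
    (hR : ∀ r s : ℝ, 0 < r → r < ρ → |s| ≤ r →
      scalarR1 φ r s = K * φ r s ^ 2 ∧ scalarR2 φ r s = 0) :
    HasConstantFlagCurvatureOn (Metric.ball 0 ρ) (sphericallySymmetric n φ) K := by
  refine hF.hasConstantFlagCurvatureOn_of_ne_zero Metric.isOpen_ball fun x hx hx0 y hy i k => ?_
  have h : (x, y) ∈ slitDomain n ρ := ⟨⟨hx, hx0⟩, hy⟩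
  have hreg := mem_regularSet hn hφ hpos hF h
  obtain ⟨h1, h2⟩ := hR ‖x‖ (sCoord x y) (slitDomain_norm_fst_pos h) (slitDomain_norm_fst_lt h)
    (abs_sCoord_le x y)
  have h3 : scalarR3 φ ‖x‖ (sCoord x y)
      = -(K * φ ‖x‖ (sCoord x y) * pds φ ‖x‖ (sCoord x y)) := by
    have := scalarR3_eq hφ hreg
    rw [h1, h2] at this
    refine mul_left_cancel₀ hreg.2.1.ne' ?_
    linear_combination this
  rw [riemannCurvature_sphericallySymmetric hn hφ hpos hF h i k rfl rfl rfl,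
    sum_fundamentalTensor_mul_snd hφ hF h k rfl rfl rfl, h1, h2, h3, sphericallySymmetric_eq]
  ring

/-- The quadratic form of a matrix `c δ + y ⊗ p + x ⊗ q`. -/
theorem sum_sum_contract (c : ℝ) (p q : Fin n → ℝ) (x y w : EuclideanSpace ℝ (Fin n)) :
    ∑ i, ∑ k, w i * w k * (c * (if i = k then 1 else 0) + y i * p k + x i * q k)
      = c * ‖w‖ ^ 2 + inner ℝ y w * (∑ k, p k * w k) + inner ℝ x w * (∑ k, q k * w k) := by
  have e : ∀ i k, w i * w k * (c * (if i = k then 1 else 0) + y i * p k + x i * q k)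
      = (if i = k then c * (w i * w k) else 0)
        + ((y i * w i) * (p k * w k) + (x i * w i) * (q k * w k)) := by
    intro i k
    split_ifs <;> ring
  simp only [e, Finset.sum_add_distrib, Finset.sum_ite_eq, Finset.mem_univ, if_true,
    ← Finset.mul_sum, ← Finset.sum_mul, ← inner_eq_sum]
  rw [real_inner_self_eq_norm_sq]
  ring

/-- A pair of vectors with prescribed `r` and `s`. -/
theorem exists_slitDomain_eq (hn : 2 ≤ n) {r s : ℝ} (hr : 0 < r) (hrρ : r < ρ) (hs : |s| ≤ r) :
    ∃ x y : EuclideanSpace ℝ (Fin n), (x, y) ∈ slitDomain n ρ ∧ ‖x‖ = r ∧ sCoord x y = s := by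
  obtain ⟨e, f, he, hf, hef⟩ : ∃ e f : EuclideanSpace ℝ (Fin n),
      inner ℝ e e = (1 : ℝ) ∧ inner ℝ f f = (1 : ℝ) ∧ inner ℝ e f = (0 : ℝ) := by
    refine ⟨EuclideanSpace.single ⟨0, by omega⟩ 1, EuclideanSpace.single ⟨1, by omega⟩ 1,
      ?_, ?_, ?_⟩ <;> simp [EuclideanSpace.inner_single_left]
  have hm : 0 ≤ r ^ 2 - s ^ 2 := by
    have := sq_le_sq.2 (hs.trans (le_abs_self r))
    linarith
  have hx : ‖r • e‖ = r := by
    rw [← sq_eq_sq₀ (norm_nonneg _) hr.le, ← real_inner_self_eq_norm_sq, inner_smul_left,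
      inner_smul_right, he]
    simp [sq]
  have hy : ‖s • e + √(r ^ 2 - s ^ 2) • f‖ = r := by
    rw [← sq_eq_sq₀ (norm_nonneg _) hr.le, ← real_inner_self_eq_norm_sq]
    simp only [inner_add_left, inner_add_right, inner_smul_left, inner_smul_right, he, hf, hef,
      real_inner_comm e f, conj_trivial]
    linear_combination Real.mul_self_sqrt hm
  refine ⟨r • e, s • e + √(r ^ 2 - s ^ 2) • f, ⟨⟨by simpa [hx] using hrρ, ?_⟩, ?_⟩, hx, ?_⟩
  · exact norm_pos_iff.1 (hr.trans_eq hx.symm)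
  · exact norm_pos_iff.1 (hr.trans_eq hy.symm)
  · rw [sCoord, hy]
    simp only [inner_add_right, inner_smul_left, inner_smul_right, he, hef, conj_trivial]
    field_simp
    ring

/-- Testing the curvature equation on a vector orthogonal to `x` and `y` gives `R₁`, and testing it
on the component of `x` orthogonal to `y` then gives `R₂`. -/
theorem scalar_of_hasConstantFlagCurvatureOn (hn : 3 ≤ n) (hφ : JointlySmoothOn φ (rectangle ρ))
    (hpos : ∀ p ∈ rectangle ρ, 0 < φ p.1 p.2)
    (hF : IsFinslerMetricOn (Metric.ball 0 ρ) (sphericallySymmetric n φ)) {K : ℝ}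
    (hK : HasConstantFlagCurvatureOn (Metric.ball 0 ρ) (sphericallySymmetric n φ) K)
    {r s : ℝ} (hr : 0 < r) (hrρ : r < ρ) (hs : |s| ≤ r) :
    scalarR1 φ r s = K * φ r s ^ 2 ∧ scalarR2 φ r s = 0 := by
  -- contract the curvature equation twice with a vector `w`
  have key : ∀ {s : ℝ} {x y : EuclideanSpace ℝ (Fin n)}, (x, y) ∈ slitDomain n ρ → ‖x‖ = r →
      sCoord x y = s → ∀ w : EuclideanSpace ℝ (Fin n), inner ℝ y w = 0 →
      ‖y‖ ^ 2 * (scalarR1 φ r s - K * φ r s ^ 2) * ‖w‖ ^ 2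
        + scalarR2 φ r s * ‖y‖ ^ 2 * inner ℝ x w ^ 2 = 0 := by
    intro s x y h hxr hxs w hw
    have h1 : ∀ i k, (‖y‖ ^ 2 * (scalarR1 φ r s - K * φ r s ^ 2)) * (if i = k then 1 else 0)
        + y i * (‖y‖ * scalarR3 φ r s * x k - (scalarR1 φ r s + s * scalarR3 φ r s) * y k
          + K * (∑ l, fundamentalTensor (sphericallySymmetric n φ) x y k l * y l))
        + x i * (-(scalarR2 φ r s * ‖y‖ * s) * y k + scalarR2 φ r s * ‖y‖ ^ 2 * x k) = 0 := by
      intro i k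
      have := hK x h.1.1 y h.2 i k
      rw [riemannCurvature_sphericallySymmetric hn hφ hpos hF h i k hxr.symm hxs.symm rfl,
        sphericallySymmetric_eq, hxr, hxs] at this
      linear_combination this
    have h2 := sum_sum_contract (‖y‖ ^ 2 * (scalarR1 φ r s - K * φ r s ^ 2))
      (fun k => ‖y‖ * scalarR3 φ r s * x k - (scalarR1 φ r s + s * scalarR3 φ r s) * y k
          + K * (∑ l, fundamentalTensor (sphericallySymmetric n φ) x y k l * y l))
      (fun k => -(scalarR2 φ r s * ‖y‖ * s) * y k + scalarR2 φ r s * ‖y‖ ^ 2 * x k) x y w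
    simp only [h1, mul_zero, Finset.sum_const_zero, sum_linear_mul, hw] at h2
    linear_combination -h2
  have hR1 : ∀ s : ℝ, |s| ≤ r → scalarR1 φ r s - K * φ r s ^ 2 = 0 := by
    intro s hs
    obtain ⟨x, y, h, hxr, hxs⟩ := exists_slitDomain_eq (n := n) (by omega) hr hrρ hs
    obtain ⟨w, hw, hxw, hyw⟩ := exists_ne_zero_orthogonal hn x y
    have h1 := key h hxr hxs w hyw
    have hy := slitDomain_norm_snd_pos h
    have hw' := norm_pos_iff.2 hw
    rw [hxw] at h1
    have h2 : ‖y‖ ^ 2 * ‖w‖ ^ 2 * (scalarR1 φ r s - K * φ r s ^ 2) = 0 := by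
      linear_combination h1
    exact (mul_eq_zero.1 h2).resolve_left (by positivity)
  have hlt : ∀ s : ℝ, |s| < r → scalarR2 φ r s = 0 := by
    intro s hs
    obtain ⟨x, y, h, hxr, hxs⟩ := exists_slitDomain_eq (n := n) (by omega) hr hrρ hs.le
    have hy := slitDomain_norm_snd_pos h
    have hxy := inner_eq_norm_mul_sCoord (x := x) hy
    -- the component of `x` orthogonal to `y`
    have hyw : inner ℝ y (x - (s / ‖y‖) • y) = 0 := by
      rw [inner_sub_right, inner_smul_right, real_inner_comm, hxy, real_inner_self_eq_norm_sq, hxs]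
      field_simp
      ring
    have hxw : inner ℝ x (x - (s / ‖y‖) • y) = r ^ 2 - s ^ 2 := by
      rw [inner_sub_right, inner_smul_right, hxy, real_inner_self_eq_norm_sq, hxs, hxr]
      field_simp
    have h1 := key h hxr hxs _ hyw
    rw [hxw, hR1 s hs.le] at h1
    have hm : 0 < r ^ 2 - s ^ 2 := by
      have := sq_lt_sq.2 (hs.trans_le (le_abs_self r))
      linarith
    have h2 : ‖y‖ ^ 2 * (r ^ 2 - s ^ 2) ^ 2 * scalarR2 φ r s = 0 := by linear_combination h1
    exact (mul_eq_zero.1 h2).resolve_left (by positivity)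
  refine ⟨sub_eq_zero.1 (hR1 s hs), ?_⟩
  -- at `|s| = r` the vectors `x` and `y` are parallel, and `R₂ = 0` follows by continuity
  obtain ⟨x, y, h, hxr, hxs⟩ := exists_slitDomain_eq (n := n) (by omega) hr hrρ hs
  have hreg := mem_regularSet hn hφ hpos hF h
  rw [hxr, hxs] at hreg
  have hc : Filter.Tendsto (fun t : ℝ => (r, t * s)) (nhdsWithin 1 (Set.Iio 1)) (nhds (r, s)) := by
    have : Continuous fun t : ℝ => (r, t * s) := by fun_prop
    have h2 := this.tendsto 1
    rw [one_mul] at h2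
    exact h2.mono_left nhdsWithin_le_nhds
  have h1 := ((scalarR2_continuousOn hφ).continuousAt
    ((isOpen_regularSet hφ).mem_nhds hreg)).tendsto.comp hc
  refine tendsto_nhds_unique_of_eventuallyEq h1 tendsto_const_nhds ?_
  have hpos1 : ∀ᶠ t : ℝ in nhdsWithin 1 (Set.Iio 1), 0 < t :=
    nhdsWithin_le_nhds (lt_mem_nhds one_pos)
  filter_upwards [hpos1, self_mem_nhdsWithin] with t ht ht1
  refine hlt (t * s) ?_
  rw [abs_mul, abs_of_pos ht]
  calc t * |s| ≤ t * r := by gcongr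
    _ < 1 * r := by gcongr; exact ht1
    _ = r := one_mul r

end ConstantCurvature

end Finsler

end

theorem theorem1p2 (n : ℕ) (hn : 3 ≤ n) (ρ : ℝ) (hρ : 0 < ρ) (φ : ℝ → ℝ → ℝ)
    (hsmooth : ContDiffOn ℝ ∞ (fun p : ℝ × ℝ => φ p.1 p.2) (Set.Ico 0 ρ ×ˢ Set.Ioo (-ρ) ρ))
    (hpos : ∀ r ∈ Set.Ico 0 ρ, ∀ s ∈ Set.Ioo (-ρ) ρ, 0 < φ r s)
    (hF : Finsler.IsFinslerMetricOn (Metric.ball 0 ρ) (Finsler.sphericallySymmetric n φ))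
    (K : ℝ) :
    Finsler.HasConstantFlagCurvatureOn (Metric.ball 0 ρ) (Finsler.sphericallySymmetric n φ) K ↔
      ∀ r s : ℝ, 0 < r → r < ρ → |s| ≤ r →
        Finsler.scalarR1 φ r s = K * φ r s ^ 2 ∧ Finsler.scalarR2 φ r s = 0 := by
  have hφ : Finsler.JointlySmoothOn φ (Finsler.rectangle ρ) :=
    ContDiffOn.mono hsmooth (Set.prod_mono Set.Ioo_subset_Ico_self subset_rfl)
  have hpos' : ∀ p ∈ Finsler.rectangle ρ, 0 < φ p.1 p.2 :=
    fun p hp => hpos p.1 (Set.Ioo_subset_Ico_self hp.1) p.2 hp.2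
  exact ⟨fun hK r s hr hrρ hs =>
    Finsler.scalar_of_hasConstantFlagCurvatureOn hn hφ hpos' hF hK hr hrρ hs,
    Finsler.hasConstantFlagCurvatureOn_of_scalar hn hφ hpos' hF⟩
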